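/- Let $n\ge m$ and let $X\in\mathbb{R}^{n\times m}$ be a random matrix with independent entries $X_{ij}\sim \mathrm{N}(M_{ij},1)$, where the mean matrix $M\in\mathbb{R}^{n\times m}$ is unknown. Estimators $\hat M=\hat M(X)$ of $M$ are compared through the Frobenius risk $\mathrm{E}_M\|\hat M-M\|_{\mathrm F}^2=\mathrm{E}_M\sum_{i=1}^n\sum_{j=1}^m(\hat M_{ij}-M_{ij})^2$, and $\hat M$ is called minimax if $\sup_{M}\mathrm{E}_M\|\hat M-M\|_{\mathrm F}^2$ equals the infimum, over all (possibly randomized) estimators, of the supremum of the risk over $M\in\mathbb{R}^{n\times m}$. Let $X=U\,\mathrm{diag}(s_1,\dots,s_m)\,V^\top$ be a singular value decomposition, where $U\in\mathbb{R}^{n\times m}$, $V\in\mathbb{R}^{m\times m}$, $U^\top U=V^\top V=I_m$ and $s_1\ge\dots\ge s_m\ge 0$. For $p>0$ and $\alpha\ge 0$ let $$\hat M_{p,\alpha}=U\,\mathrm{diag}(\hat\sigma_1,\dots,\hat\sigma_m)\,V^\top,\qquad \hat\sigma_i=\Big(1-\alpha\,\frac{s_i^{p-2}}{\sum_{j=1}^m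 s_j^p}\Big)s_i,$$ where $\hat\sigma_i=0$ if $s_i=0$ (for $m\ge1$, some $s_i=0$ only for $X$ in a Lebesgue null set). This does not depend on the choice of the singular value decomposition. **Theorem 1.** 1. For $p\in[1,2]$, $\hat M_{p,\alpha}$ is minimax if $0\le\alpha\le 2nm-(2-p)m(m+1)-2p$. 2. For $p\in(0,1)$, $\hat M_{p,\alpha}$ is minimax if $0\le\alpha\le 2nm-2m(m+1)+2(m-1)p$. -/

import Mathlib

open MeasureTheory ProbabilityTheory Matrix
open scoped ENNReal

namespace NormalMeanMatrix

/-- Real matrices carry the product (Borel) σ-algebra of their entries. -/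
instance instMeasurableSpaceMatrix {n m : ℕ} : MeasurableSpace (Matrix (Fin n) (Fin m) ℝ) :=
  inferInstanceAs (MeasurableSpace (Fin n → Fin m → ℝ))

/-! ### The normal mean matrix model and minimaxity -/

/-- The law of a random matrix with independent entries `X i j ∼ N(M i j, 1)`. -/
noncomputable def normalMatrix {n m : ℕ} (M : Matrix (Fin n) (Fin m) ℝ) :
    Measure (Matrix (Fin n) (Fin m) ℝ) :=
  Measure.pi (fun i => Measure.pi (fun j => gaussianReal (M i j) 1))

instance instIsProbabilityMeasureNormalMatrix {n m : ℕ} (M : Matrix (Fin n) (Fin m) ℝ) :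
    IsProbabilityMeasure (normalMatrix M) := by
  have h (i : Fin n) : IsProbabilityMeasure (Measure.pi (fun j => gaussianReal (M i j) 1)) :=
    inferInstance
  exact Measure.pi.instIsProbabilityMeasure (fun i => Measure.pi (fun j => gaussianReal (M i j) 1))

theorem normalMatrix_eq_map {n m : ℕ} (M : Matrix (Fin n) (Fin m) ℝ) :
    normalMatrix M = (normalMatrix (0 : Matrix (Fin n) (Fin m) ℝ)).map (fun Z => M + Z) := by
  have h1 : ∀ i : Fin n, Measure.pi (fun j => gaussianReal (M i j) 1) =
      (Measure.pi (fun _ : Fin m => gaussianReal 0 1)).map (fun z j => M i j + z j) := by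
    intro i
    have h := Measure.pi_map_pi (μ := fun _ : Fin m => gaussianReal 0 1)
      (f := fun j z => M i j + z) (fun j => (measurable_const_add (M i j)).aemeasurable)
    rw [h]
    congr 1
    funext j
    rw [gaussianReal_map_const_add, zero_add]
  have h2 := Measure.pi_map_pi
    (μ := fun _ : Fin n => Measure.pi (fun _ : Fin m => gaussianReal 0 1))
    (f := fun i z j => M i j + z j)
    (fun i => (measurable_pi_lambda _ fun j =>
      (measurable_pi_apply j).const_add (M i j)).aemeasurable)
  have h3 : normalMatrix M = Measure.pi (fun i =>
      (Measure.pi (fun _ : Fin m => gaussianReal 0 1)).map (fun z j => M i j + z j)) := by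
    unfold normalMatrix
    exact congrArg _ (funext h1)
  rw [h3]
  exact h2.symm

/-- The statistical model `M ↦ normalMatrix M` as a Markov kernel. -/
noncomputable def normalModel (n m : ℕ) :
    Kernel (Matrix (Fin n) (Fin m) ℝ) (Matrix (Fin n) (Fin m) ℝ) where
  toFun := normalMatrix
  measurable' := by
    have hadd : Measurable (fun z : Matrix (Fin n) (Fin m) ℝ × Matrix (Fin n) (Fin m) ℝ =>
        z.1 + z.2) := by
      refine measurable_pi_lambda _ fun i => measurable_pi_lambda _ fun j => ?_
      have e1 : Measurable (fun A : Matrix (Fin n) (Fin m) ℝ => A i j) :=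
        (measurable_pi_apply j).comp (measurable_pi_apply (X := fun _ : Fin n => Fin m → ℝ) i)
      exact (e1.comp measurable_fst).add (e1.comp measurable_snd)
    refine Measure.measurable_of_measurable_coe _ fun s hs => ?_
    have hM : ∀ M : Matrix (Fin n) (Fin m) ℝ, normalMatrix M s =
        normalMatrix (0 : Matrix (Fin n) (Fin m) ℝ)
          (Prod.mk M ⁻¹' ((fun z : Matrix (Fin n) (Fin m) ℝ × Matrix (Fin n) (Fin m) ℝ =>
            z.1 + z.2) ⁻¹' s)) := by
      intro M
      have hm : Measurable (fun Z : Matrix (Fin n) (Fin m) ℝ => M + Z) :=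
        hadd.comp measurable_prodMk_left
      rw [normalMatrix_eq_map M, Measure.map_apply hm hs]
      rfl
    simp_rw [hM]
    exact measurable_measure_prodMk_left (hadd hs)

/-- The Frobenius loss `‖D - M‖_F²` of the estimate `D` of `M`. -/
noncomputable def frobeniusLoss {n m : ℕ} (M D : Matrix (Fin n) (Fin m) ℝ) : ℝ≥0∞ :=
  ENNReal.ofReal (∑ i, ∑ j, (D i j - M i j) ^ 2)

/-- The Frobenius risk `E_M ‖δ(X) - M‖_F²` of the estimator `δ` at the mean matrix `M`. -/
noncomputable def frobeniusRisk {n m : ℕ}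
    (δ : Matrix (Fin n) (Fin m) ℝ → Matrix (Fin n) (Fin m) ℝ) (M : Matrix (Fin n) (Fin m) ℝ) :
    ℝ≥0∞ :=
  ∫⁻ X, frobeniusLoss M (δ X) ∂(normalModel n m M)

/-- `δ` is a minimax estimator: it is measurable, and its maximal risk equals the infimum of the
maximal risks of all (possibly randomized) estimators. -/
def IsMinimax {n m : ℕ} (δ : Matrix (Fin n) (Fin m) ℝ → Matrix (Fin n) (Fin m) ℝ) : Prop :=
  Measurable δ ∧ ⨆ M, frobeniusRisk δ M = minimaxRisk frobeniusLoss (normalModel n m)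

/-! ### Singular value decompositions and equivariant estimators -/

/-- `X = U diag(s) Vᵀ` is a (thin) singular value decomposition of the `n × m` matrix `X`. -/
structure IsSVD {n m : ℕ} (X : Matrix (Fin n) (Fin m) ℝ) (U : Matrix (Fin n) (Fin m) ℝ)
    (s : Fin m → ℝ) (V : Matrix (Fin m) (Fin m) ℝ) : Prop where
  left_orthonormal : Uᵀ * U = 1
  right_orthonormal : Vᵀ * V = 1
  antitone : Antitone s
  nonneg : ∀ i, 0 ≤ s i
  eq : X = U * diagonal s * Vᵀ

theorem exists_isSVD {n m : ℕ} (hmn : m ≤ n) (X : Matrix (Fin n) (Fin m) ℝ) :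
    ∃ (U : Matrix (Fin n) (Fin m) ℝ) (s : Fin m → ℝ) (V : Matrix (Fin m) (Fin m) ℝ),
      IsSVD X U s V := by
  have hn : Module.finrank ℝ (EuclideanSpace ℝ (Fin m)) = m := by simp
  let T := Matrix.toEuclideanLin X
  have hT := T.isSymmetric_adjoint_comp_self
  let v := hT.eigenvectorBasis hn
  let s : Fin m → ℝ := fun i => T.singularValues i
  have hin : ∀ i j, inner ℝ (T (v i)) (T (v j)) = if i = j then s j ^ 2 else 0 := by
    intro i j
    have h1 : inner ℝ (T (v i)) (T (v j)) = inner ℝ (v i) ((T.adjoint ∘ₗ T) (v j)) := by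
      rw [LinearMap.comp_apply, LinearMap.adjoint_inner_right]
    rw [h1, hT.apply_eigenvectorBasis hn j, ← T.sq_singularValues_fin hn j, inner_smul_right,
      orthonormal_iff_ite.mp v.orthonormal i j]
    simp [s]
  let w : Fin n → EuclideanSpace ℝ (Fin n) := fun i =>
    if h : (i : ℕ) < m then (s ⟨i, h⟩)⁻¹ • T (v ⟨i, h⟩) else 0
  let S : Set (Fin n) := {i | ∃ h : (i : ℕ) < m, s ⟨i, h⟩ ≠ 0}
  have hw : Orthonormal ℝ (S.domRestrict w) := by
    rw [orthonormal_iff_ite]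
    rintro ⟨i, hi, hsi⟩ ⟨j, hj, hsj⟩
    simp only [Set.domRestrict_apply, w, dif_pos hi, dif_pos hj, inner_smul_left,
      inner_smul_right, hin, Subtype.mk.injEq, Fin.ext_iff]
    split_ifs with hij
    · have : (⟨i, hi⟩ : Fin m) = ⟨j, hj⟩ := Fin.ext hij
      rw [this]
      simp only [RCLike.conj_to_real]
      field_simp
    · simp
  obtain ⟨b, hb⟩ := hw.exists_orthonormalBasis_extension_of_card_eq (by simp)
  have hTv : ∀ j : Fin m, T (v j) = s j • b (Fin.castLE hmn j) := by
    intro j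
    by_cases hj : s j = 0
    · have h0 := hin j j
      rw [if_pos rfl, hj] at h0
      rw [hj, zero_smul]
      exact inner_self_eq_zero.mp (h0.trans (zero_pow two_ne_zero))
    · rw [hb (Fin.castLE hmn j) ⟨j.2, hj⟩]
      simp only [w, Fin.val_castLE, Fin.is_lt, dif_pos, Fin.eta]
      rw [smul_inv_smul₀ hj]
  have hV : (Matrix.of fun k j => v j k : Matrix (Fin m) (Fin m) ℝ)ᵀ *
      (Matrix.of fun k j => v j k) = 1 := by
    ext i j
    have := orthonormal_iff_ite.mp v.orthonormal j i
    rw [PiLp.inner_apply] at this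
    simp only [Matrix.mul_apply, Matrix.transpose_apply, Matrix.of_apply, Matrix.one_apply]
    simpa [eq_comm] using this
  refine ⟨Matrix.of fun k j => b (Fin.castLE hmn j) k, s, Matrix.of fun k j => v j k,
    ?_, hV, ?_, ?_, ?_⟩
  · ext i j
    have := orthonormal_iff_ite.mp b.orthonormal (Fin.castLE hmn j) (Fin.castLE hmn i)
    rw [PiLp.inner_apply] at this
    simp only [Matrix.mul_apply, Matrix.transpose_apply, Matrix.of_apply, Matrix.one_apply]
    simpa [eq_comm] using this
  · exact fun i j hij => T.singularValues_antitone hij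
  · exact fun i => T.singularValues_nonneg i
  · have hXV : X * (Matrix.of fun k j => v j k : Matrix (Fin m) (Fin m) ℝ) =
        (Matrix.of fun k j => b (Fin.castLE hmn j) k : Matrix (Fin n) (Fin m) ℝ) *
          diagonal s := by
      ext k j
      have := congrArg (fun x : EuclideanSpace ℝ (Fin n) => x k) (hTv j)
      simp only [T, Matrix.toLpLin_apply, Matrix.mulVec, dotProduct, PiLp.smul_apply,
        smul_eq_mul] at this
      rw [Matrix.mul_diagonal, Matrix.mul_apply]
      simp only [Matrix.of_apply]
      rw [this, mul_comm]
    rw [← hXV, Matrix.mul_assoc, mul_eq_one_comm.mp hV, Matrix.mul_one]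

open Classical in
/-- The equivariant estimator `U diag(σ₁(s), …, σₘ(s)) Vᵀ`, where `X = U diag(s) Vᵀ` is a singular
value decomposition of `X`. (The second branch is void for `m ≤ n`.) -/
noncomputable def equivariantEstimator {n m : ℕ} (σ : (Fin m → ℝ) → Fin m → ℝ)
    (X : Matrix (Fin n) (Fin m) ℝ) : Matrix (Fin n) (Fin m) ℝ :=
  if h : ∃ (d : Matrix (Fin n) (Fin m) ℝ × (Fin m → ℝ) × Matrix (Fin m) (Fin m) ℝ),
      IsSVD X d.1 d.2.1 d.2.2 then
    h.choose.1 * diagonal (σ h.choose.2.1) * h.choose.2.2ᵀ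
  else X

/-- The shrunken singular values `(1 - α sᵢ^(p-2) / ∑ⱼ sⱼ^p) sᵢ`; the value is `0` if `sᵢ = 0`. -/
noncomputable def normShrinkage {m : ℕ} (p α : ℝ) (s : Fin m → ℝ) (i : Fin m) : ℝ :=
  (1 - α * (s i ^ (p - 2) / ∑ j, s j ^ p)) * s i

/-- The matrix norm shrinkage estimator `M̂_{p,α}`. -/
noncomputable def normShrinkageEstimator {n m : ℕ} (p α : ℝ) :
    Matrix (Fin n) (Fin m) ℝ → Matrix (Fin n) (Fin m) ℝ :=
  equivariantEstimator (normShrinkage p α)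

theorem IsSVD.singularValues_unique {n m : ℕ} {X U U' : Matrix (Fin n) (Fin m) ℝ}
    {s s' : Fin m → ℝ} {V V' : Matrix (Fin m) (Fin m) ℝ}
    (h : IsSVD X U s V) (h' : IsSVD X U' s' V') : s = s' := by
  have key : ∀ {U : Matrix (Fin n) (Fin m) ℝ} {s : Fin m → ℝ} {V : Matrix (Fin m) (Fin m) ℝ},
      IsSVD X U s V → (Xᵀ * X).charpoly.roots =
        Multiset.map (fun i => s i ^ 2) Finset.univ.val := by
    intro U s V h
    have h1 : Xᵀ * X = V * (diagonal (fun i => s i ^ 2) * Vᵀ) := by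
      conv_lhs => rw [h.eq]
      simp only [Matrix.transpose_mul, Matrix.transpose_transpose, Matrix.diagonal_transpose]
      calc V * (diagonal s * Uᵀ) * (U * diagonal s * Vᵀ)
          = V * (diagonal s * (Uᵀ * U) * diagonal s * Vᵀ) := by simp only [Matrix.mul_assoc]
        _ = _ := by
          rw [h.left_orthonormal, Matrix.mul_one, Matrix.diagonal_mul_diagonal]
          simp only [sq]
    rw [h1, Matrix.charpoly_mul_comm, Matrix.mul_assoc, h.right_orthonormal, Matrix.mul_one,
      Matrix.charpoly_diagonal]
    exact Polynomial.roots_multiset_prod_X_sub_C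
      (Multiset.map (fun i => s i ^ 2) Finset.univ.val) ▸ by
        simp [Finset.prod, Function.comp_def]
  have h2 := (key h).symm.trans (key h')
  have h3 : ∀ {s : Fin m → ℝ}, Antitone s → (∀ i, 0 ≤ s i) → Antitone (fun i => s i ^ 2) :=
    fun ha h0 i j hij => pow_le_pow_left₀ (h0 j) (ha hij) 2
  have h4 : List.ofFn (fun i => s i ^ 2) = List.ofFn (fun i => s' i ^ 2) := by
    refine List.Perm.eq_of_sortedGE (List.sortedGE_ofFn_iff.mpr (h3 h.antitone h.nonneg))
      (List.sortedGE_ofFn_iff.mpr (h3 h'.antitone h'.nonneg)) ?_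
    rw [← Multiset.coe_eq_coe]
    simpa [Fin.univ_val_map] using h2
  have h5 := List.ofFn_injective h4
  funext i
  exact (pow_left_inj₀ (h.nonneg i) (h'.nonneg i) two_ne_zero).mp (congrFun h5 i)

/-- The estimator does not depend on the choice of the singular value decomposition. -/
theorem normShrinkageEstimator_eq {n m : ℕ} (p α : ℝ) {X U : Matrix (Fin n) (Fin m) ℝ}
    {s : Fin m → ℝ} {V : Matrix (Fin m) (Fin m) ℝ} (h : IsSVD X U s V) :
    normShrinkageEstimator p α X = U * diagonal (normShrinkage p α s) * Vᵀ := by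
  have hex : ∃ (d : Matrix (Fin n) (Fin m) ℝ × (Fin m → ℝ) × Matrix (Fin m) (Fin m) ℝ),
      IsSVD X d.1 d.2.1 d.2.2 := ⟨(U, s, V), h⟩
  have h' := hex.choose_spec
  have hdef : normShrinkageEstimator p α X = hex.choose.1 *
      diagonal (normShrinkage p α hex.choose.2.1) * hex.choose.2.2ᵀ := by
    unfold normShrinkageEstimator equivariantEstimator
    rw [dif_pos hex]
  rw [hdef]
  generalize hex.choose.1 = U' at h'
  generalize hex.choose.2.1 = s' at h'
  generalize hex.choose.2.2 = V' at h'
  obtain rfl := h.singularValues_unique h'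
  -- both sides equal `X * (V * diagonal d * Vᵀ)`, and the latter does not depend on `V`
  set d : Fin m → ℝ := fun i => 1 - α * (s i ^ (p - 2) / ∑ j, s j ^ p) with hd
  have key : ∀ {U : Matrix (Fin n) (Fin m) ℝ} {V : Matrix (Fin m) (Fin m) ℝ},
      IsSVD X U s V → U * diagonal (normShrinkage p α s) * Vᵀ = X * (V * diagonal d * Vᵀ) := by
    intro U V h
    have hs : diagonal (normShrinkage p α s) = diagonal s * diagonal d := by
      rw [Matrix.diagonal_mul_diagonal]
      congr 1
      funext i
      simp only [normShrinkage, hd, mul_comm]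
    conv_rhs => rw [h.eq]
    calc U * diagonal (normShrinkage p α s) * Vᵀ
        = U * diagonal s * (1 : Matrix (Fin m) (Fin m) ℝ) * diagonal d * Vᵀ := by
          rw [hs, Matrix.mul_one]; simp only [Matrix.mul_assoc]
      _ = _ := by rw [← h.right_orthonormal]; simp only [Matrix.mul_assoc]
  rw [key h, key h']
  congr 1
  have hgram : ∀ {U : Matrix (Fin n) (Fin m) ℝ} {V : Matrix (Fin m) (Fin m) ℝ},
      IsSVD X U s V → Xᵀ * X * V = V * diagonal (fun i => s i ^ 2) := by
    intro U V h
    have h1 : X * V = U * diagonal s := by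
      conv_lhs => rw [h.eq]
      rw [Matrix.mul_assoc, h.right_orthonormal, Matrix.mul_one]
    rw [Matrix.mul_assoc, h1, h.eq]
    simp only [Matrix.transpose_mul, Matrix.transpose_transpose, Matrix.diagonal_transpose]
    calc V * (diagonal s * Uᵀ) * (U * diagonal s)
        = V * (diagonal s * (Uᵀ * U) * diagonal s) := by simp only [Matrix.mul_assoc]
      _ = _ := by
        rw [h.left_orthonormal, Matrix.mul_one, Matrix.diagonal_mul_diagonal]
        simp only [sq]
  have hW : (Vᵀ * V') * diagonal (fun i => s i ^ 2) =
      diagonal (fun i => s i ^ 2) * (Vᵀ * V') := by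
    have h1 := congrArg (fun A => Aᵀ) (hgram h)
    simp only [Matrix.transpose_mul, Matrix.transpose_transpose,
      Matrix.diagonal_transpose] at h1
    calc (Vᵀ * V') * diagonal (fun i => s i ^ 2)
        = Vᵀ * (V' * diagonal (fun i => s i ^ 2)) := by rw [Matrix.mul_assoc]
      _ = Vᵀ * (Xᵀ * X) * V' := by rw [← hgram h', Matrix.mul_assoc Vᵀ]
      _ = _ := by rw [h1, Matrix.mul_assoc]
  have hWd : (Vᵀ * V') * diagonal d = diagonal d * (Vᵀ * V') := by
    ext i j
    have hij := congrFun (congrFun hW i) j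
    rw [Matrix.mul_diagonal, Matrix.diagonal_mul] at hij ⊢
    by_cases h0 : (Vᵀ * V') i j = 0
    · rw [h0]; ring
    · have : s j ^ 2 = s i ^ 2 := mul_left_cancel₀ h0 (hij.trans (mul_comm _ _))
      have : s j = s i :=
        (pow_left_inj₀ (h.nonneg j) (h.nonneg i) two_ne_zero).mp this
      simp only [hd, this]
      ring
  have hV := mul_eq_one_comm.mp h.right_orthonormal
  have hV' := mul_eq_one_comm.mp h'.right_orthonormal
  calc V' * diagonal d * V'ᵀ = (V * Vᵀ) * V' * diagonal d * V'ᵀ := by rw [hV, Matrix.one_mul]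
    _ = V * ((Vᵀ * V') * diagonal d) * V'ᵀ := by simp only [Matrix.mul_assoc]
    _ = V * diagonal d * Vᵀ * (V' * V'ᵀ) := by rw [hWd]; simp only [Matrix.mul_assoc]
    _ = V * diagonal d * Vᵀ := by rw [hV', Matrix.mul_one]

end NormalMeanMatrix

/-! The constant risk of `X` itself is `n m`, and `n m` is also the minimax risk: under the prior
with independent `N(0, cot² θ)` entries the Bayes risk is `n m cos² θ`, which tends to `n m` as
`θ → 0` (`le_minimaxRisk`). The Bayes risk is computed without conditional laws. With `Z₁`, `Z₂`
independent standard normal matrices, parameter and observation are `cot θ • Z₁` and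
`cot θ • Z₁ + Z₂`; rotating the pair `(Z₁, Z₂)` by `θ`, which preserves its law, makes the
observation a function of one component and leaves the other one as an independent error.

It remains to bound the risk of the shrinkage estimator by `n m`. The estimator is singular where
`X` loses rank, so it is approximated by `X + g`, where, with `q = p / 2` and `ε > 0`,

  `g(X) = -α X (Xᵀ X + ε) ^ (q - 1) / tr (Xᵀ X + ε) ^ q`

is bounded with bounded partial derivatives. As `ε → 0` these estimators converge to the shrinkage
estimator at every matrix (`tendsto_add_smoothField`), which gives its measurability, and, by
Fatou's lemma, the bound on its risk. For `X + g` Stein's identity turns the risk into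
`n m + E (‖g‖² + 2 div g)`, and the expression under the expectation is nonpositive everywhere
(`IsAdmissible.unbiased_excess_risk_nonpos`).

The last assertion has an analytic and a scalar part. The Daletskii–Krein formula
(`IsSVD.hasDerivAt_cfc_gram`) differentiates powers of `Xᵀ X + ε` and expresses `div g` through
divided differences of powers at the numbers `tᵢ = sᵢ² + ε`, where `sᵢ` are the singular values; it
holds for repeated and for vanishing singular values alike, so that no null set has to be removed.
The scalar part is the inequality

  `(α + 4 q) ∑ tᵢ ^ (2 q - 1) ≤
    2 (∑ tᵢ ^ q) ((n - m + 2 q - 1) ∑ tᵢ ^ (q - 1) + ∑_{i ≠ j} (tᵢ ^ q - tⱼ ^ q) / (tᵢ - tⱼ))`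

(`IsAdmissible.mul_sum_rpow_le`), where quotients with `tᵢ = tⱼ` are read as the derivative
`q tᵢ ^ (q - 1)`. Chebyshev's sum inequality bounds the term with
`∑ tᵢ ^ (q - 1)`. For `p < 1` the divided differences are merely nonnegative. For `p ≥ 1` they are
bounded below by `q (tᵢ ^ (2 q - 1) + tⱼ ^ (2 q - 1)) / (tᵢ ^ q + tⱼ ^ q)`, since the trapezoidal
rule underestimates the integral of the concave function `x ^ (p - 1)` between `tⱼ` and `tᵢ`, and
Chebyshev's inequality applies once more. This accounts for the two ranges of `α`. -/

namespace NormalMeanMatrix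

open Filter Topology

/-! ### Spectral functions of the Gram matrix -/

theorem IsSVD.gram_eq {n m : ℕ} {X U : Matrix (Fin n) (Fin m) ℝ} {s : Fin m → ℝ}
    {V : Matrix (Fin m) (Fin m) ℝ} (h : IsSVD X U s V) :
    Xᵀ * X = V * diagonal (fun i => s i ^ 2) * Vᵀ := by
  conv_lhs => rw [h.eq]
  simp only [Matrix.transpose_mul, Matrix.transpose_transpose, Matrix.diagonal_transpose]
  calc V * (diagonal s * Uᵀ) * (U * diagonal s * Vᵀ)
      = V * (diagonal s * (Uᵀ * U) * diagonal s) * Vᵀ := by simp only [Matrix.mul_assoc]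
    _ = _ := by
      rw [h.left_orthonormal, Matrix.mul_one, Matrix.diagonal_mul_diagonal]
      simp only [sq]

theorem IsSVD.mul_right {n m : ℕ} {X U : Matrix (Fin n) (Fin m) ℝ} {s : Fin m → ℝ}
    {V : Matrix (Fin m) (Fin m) ℝ} (h : IsSVD X U s V) : X * V = U * diagonal s := by
  conv_lhs => rw [h.eq]
  rw [Matrix.mul_assoc, h.right_orthonormal, Matrix.mul_one]

/-- Polynomials act on an orthogonally diagonalized matrix through its eigenvalues. -/
theorem aeval_conj_diagonal {m : ℕ} {V : Matrix (Fin m) (Fin m) ℝ} (hV : Vᵀ * V = 1)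
    (t : Fin m → ℝ) (Q : Polynomial ℝ) :
    Polynomial.aeval (V * diagonal t * Vᵀ) Q = V * diagonal (fun i => Q.eval (t i)) * Vᵀ := by
  have hV' := mul_eq_one_comm.mp hV
  induction Q using Polynomial.induction_on' with
  | add P Q hP hQ =>
    rw [map_add, hP, hQ, ← Matrix.add_mul, ← Matrix.mul_add, diagonal_add]
    simp only [Polynomial.eval_add]
  | monomial k a =>
    have hpow : ∀ k : ℕ, (V * diagonal t * Vᵀ) ^ k = V * diagonal (fun i => t i ^ k) * Vᵀ := by
      intro k
      induction k with
      | zero => simp [hV']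
      | succ k ih =>
        rw [pow_succ, ih]
        calc V * diagonal (fun i => t i ^ k) * Vᵀ * (V * diagonal t * Vᵀ)
            = V * (diagonal (fun i => t i ^ k) * (Vᵀ * V) * diagonal t) * Vᵀ := by
              simp only [Matrix.mul_assoc]
          _ = _ := by rw [hV, Matrix.mul_one, diagonal_mul_diagonal]; simp only [pow_succ]
    rw [Polynomial.aeval_monomial, hpow, ← Algebra.smul_def, ← Matrix.smul_mul, ← Matrix.mul_smul]
    congr 2
    ext i j
    by_cases hij : i = j <;> simp [hij]

theorem isSelfAdjoint_conj_diagonal {m : ℕ} (V : Matrix (Fin m) (Fin m) ℝ) (t : Fin m → ℝ) :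
    IsSelfAdjoint (V * diagonal t * Vᵀ) := by
  rw [IsSelfAdjoint, Matrix.star_eq_conjTranspose, Matrix.conjTranspose_eq_transpose_of_trivial]
  simp [Matrix.transpose_mul, Matrix.mul_assoc]

/-- The continuous functional calculus of an orthogonally diagonalized matrix. -/
theorem cfc_conj_diagonal {m : ℕ} {V : Matrix (Fin m) (Fin m) ℝ} (hV : Vᵀ * V = 1)
    (t : Fin m → ℝ) (f : ℝ → ℝ) :
    cfc f (V * diagonal t * Vᵀ) = V * diagonal (fun i => f (t i)) * Vᵀ := by
  obtain ⟨Q, hQ⟩ := (Polynomial.exists_eval_eq_iff t (fun i => f (t i))).mpr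
    (fun i j hij => by simp only [hij])
  have hspec : spectrum ℝ (V * diagonal t * Vᵀ) = Set.range t := by
    let u : (Matrix (Fin m) (Fin m) ℝ)ˣ := ⟨V, Vᵀ, mul_eq_one_comm.mp hV, hV⟩
    have := spectrum.units_conjugate (R := ℝ) (a := diagonal t) (u := u)
    rw [spectrum_diagonal] at this
    exact this
  have heq : (spectrum ℝ (V * diagonal t * Vᵀ)).EqOn f Q.eval := by
    rw [hspec]
    rintro _ ⟨i, rfl⟩
    exact (hQ i).symm
  rw [cfc_congr heq, cfc_polynomial _ _ (isSelfAdjoint_conj_diagonal V t),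
    aeval_conj_diagonal hV]
  simp only [hQ]

theorem IsSVD.cfc_gram {n m : ℕ} {X U : Matrix (Fin n) (Fin m) ℝ} {s : Fin m → ℝ}
    {V : Matrix (Fin m) (Fin m) ℝ} (h : IsSVD X U s V) (f : ℝ → ℝ) :
    cfc f (Xᵀ * X) = V * diagonal (fun i => f (s i ^ 2)) * Vᵀ := by
  rw [h.gram_eq, cfc_conj_diagonal h.right_orthonormal]

theorem conj_diagonal_apply {n m l : ℕ} (U : Matrix (Fin n) (Fin m) ℝ) (c : Fin m → ℝ)
    (V : Matrix (Fin l) (Fin m) ℝ) (i : Fin n) (j : Fin l) :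
    (U * diagonal c * Vᵀ) i j = ∑ μ, U i μ * c μ * V j μ := by
  rw [Matrix.mul_apply]
  simp only [Matrix.mul_diagonal, Matrix.transpose_apply]

theorem sum_row_sq {m : ℕ} {V : Matrix (Fin m) (Fin m) ℝ} (hV : Vᵀ * V = 1) (k : Fin m) :
    ∑ μ, V k μ ^ 2 = 1 := by
  have := congrFun (congrFun (show V * Vᵀ = 1 from mul_eq_one_comm.mp hV) k) k
  rw [Matrix.mul_apply] at this
  simpa [sq] using this

theorem abs_conj_diagonal_le {m : ℕ} {V : Matrix (Fin m) (Fin m) ℝ} (hV : Vᵀ * V = 1)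
    {c : Fin m → ℝ} {δ : ℝ} (hc : ∀ i, |c i| ≤ δ) (k l : Fin m) :
    |(V * diagonal c * Vᵀ) k l| ≤ δ := by
  rw [conj_diagonal_apply]
  calc |∑ μ, V k μ * c μ * V l μ| ≤ ∑ μ, δ * (V k μ ^ 2 / 2 + V l μ ^ 2 / 2) := by
        refine (Finset.abs_sum_le_sum_abs _ _).trans (Finset.sum_le_sum fun μ _ => ?_)
        have h1 : |V k μ| * |V l μ| ≤ V k μ ^ 2 / 2 + V l μ ^ 2 / 2 := by
          nlinarith [sq_nonneg (|V k μ| - |V l μ|), sq_abs (V k μ), sq_abs (V l μ)]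
        have h0 : 0 ≤ |V k μ| * |V l μ| := by positivity
        calc |V k μ * c μ * V l μ| = |c μ| * (|V k μ| * |V l μ|) := by
              rw [abs_mul, abs_mul]; ring
          _ ≤ δ * (|V k μ| * |V l μ|) := mul_le_mul_of_nonneg_right (hc μ) h0
          _ ≤ _ := mul_le_mul_of_nonneg_left h1 ((abs_nonneg _).trans (hc μ))
    _ = δ := by
        rw [← Finset.mul_sum, Finset.sum_add_distrib, ← Finset.sum_div, ← Finset.sum_div,
          sum_row_sq hV, sum_row_sq hV]
        ring

theorem IsSVD.sum_sq {n m : ℕ} {X U : Matrix (Fin n) (Fin m) ℝ} {s : Fin m → ℝ}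
    {V : Matrix (Fin m) (Fin m) ℝ} (h : IsSVD X U s V) :
    ∑ i, s i ^ 2 = (Xᵀ * X).trace := by
  rw [h.gram_eq, Matrix.trace_mul_comm, ← Matrix.mul_assoc, h.right_orthonormal, Matrix.one_mul,
    Matrix.trace_diagonal]

/-- A continuous function of the Gram matrix `Xᵀ X` depends continuously on `X`: on a bounded set
of matrices it is a uniform limit of polynomials in `Xᵀ X`. -/
theorem continuous_cfc_gram {n m : ℕ} (hmn : m ≤ n) {f : ℝ → ℝ}
    (hf : ContinuousOn f (Set.Ici 0)) :
    Continuous fun X : Matrix (Fin n) (Fin m) ℝ => cfc f (Xᵀ * X) := by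
  refine continuous_matrix fun k l => ?_
  refine continuous_of_locally_uniform_approx_of_continuousAt fun X u hu => ?_
  obtain ⟨δ, hδ, hδu⟩ := Metric.mem_uniformity_dist.mp hu
  set L := (Xᵀ * X).trace + 1
  have hcont : Continuous fun Y : Matrix (Fin n) (Fin m) ℝ => (Yᵀ * Y).trace :=
    (continuous_id.matrix_transpose.matrix_mul continuous_id).matrix_trace
  obtain ⟨Q, hQ⟩ := exists_polynomial_near_of_continuousOn 0 L f
    (hf.mono Set.Icc_subset_Ici_self) (δ / 2) (half_pos hδ)
  refine ⟨{Y | (Yᵀ * Y).trace < L},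
    (isOpen_lt hcont continuous_const).mem_nhds (lt_add_one (Xᵀ * X).trace),
    fun Y => (Polynomial.aeval (Yᵀ * Y) Q) k l, ?_, fun Y hY => hδu ?_⟩
  · have h1 : Continuous fun Y : Matrix (Fin n) (Fin m) ℝ => Polynomial.aeval (Yᵀ * Y) Q := by
      simp only [Polynomial.aeval_eq_sum_range]
      refine continuous_finsetSum _ fun i _ => ?_
      have h2 : Continuous fun Y : Matrix (Fin n) (Fin m) ℝ => (Yᵀ * Y) ^ i :=
        (continuous_id.matrix_transpose.matrix_mul continuous_id).pow i
      exact h2.const_smul (Q.coeff i)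
    exact (h1.matrix_elem k l).continuousAt
  · obtain ⟨U, s, V, h⟩ := exists_isSVD hmn Y
    beta_reduce
    rw [Real.dist_eq, h.cfc_gram, h.gram_eq, aeval_conj_diagonal h.right_orthonormal,
      ← Matrix.sub_apply, ← Matrix.sub_mul, ← Matrix.mul_sub, diagonal_sub]
    refine lt_of_le_of_lt (abs_conj_diagonal_le h.right_orthonormal (δ := δ / 2) (fun i => ?_) k l)
      (half_lt_self hδ)
    have hs : s i ^ 2 ≤ L := by
      have h2 : s i ^ 2 ≤ ∑ j, s j ^ 2 :=
        Finset.single_le_sum (f := fun j => s j ^ 2) (fun j _ => sq_nonneg _) (Finset.mem_univ i)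
      exact h2.trans (h.sum_sq.trans_lt hY).le
    rw [abs_sub_comm]
    exact (hQ _ ⟨sq_nonneg _, hs⟩).le

/-- The Daletskii–Krein difference formula, in the eigenbasis of one of the two matrices. -/
theorem cfc_sub_cfc {m : ℕ} {V W : Matrix (Fin m) (Fin m) ℝ} (hV : Vᵀ * V = 1) (hW : Wᵀ * W = 1)
    (t τ : Fin m → ℝ) (f : ℝ → ℝ) :
    cfc f (W * diagonal τ * Wᵀ) - cfc f (V * diagonal t * Vᵀ) =
      ∑ ν, cfc (dslope f (t ν)) (W * diagonal τ * Wᵀ) *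
        (W * diagonal τ * Wᵀ - V * diagonal t * Vᵀ) * (V * diagonal (Pi.single ν 1) * Vᵀ) := by
  have hV' := mul_eq_one_comm.mp hV
  have hW' := mul_eq_one_comm.mp hW
  have hsum : ∑ ν, V * diagonal (Pi.single ν (1 : ℝ)) * Vᵀ = 1 := by
    rw [← Finset.sum_mul, ← Finset.mul_sum]
    have : ∑ ν : Fin m, diagonal (Pi.single ν (1 : ℝ)) = (1 : Matrix (Fin m) (Fin m) ℝ) := by
      rw [← diagonal_one]
      ext i j
      rw [Matrix.sum_apply]
      by_cases hij : i = j
      · subst hij; simp [Pi.single_apply]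
      · simp [hij]
    rw [this, Matrix.mul_one, hV']
  -- on an eigenvector of the second matrix, it acts as the eigenvalue
  have hproj : ∀ (g : Fin m → ℝ) ν, V * diagonal g * Vᵀ * (V * diagonal (Pi.single ν 1) * Vᵀ) =
      g ν • (V * diagonal (Pi.single ν 1) * Vᵀ) := by
    intro g ν
    calc V * diagonal g * Vᵀ * (V * diagonal (Pi.single ν 1) * Vᵀ)
        = V * (diagonal g * (Vᵀ * V) * diagonal (Pi.single ν 1)) * Vᵀ := by
          simp only [Matrix.mul_assoc]
      _ = V * (g ν • diagonal (Pi.single ν 1)) * Vᵀ := by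
          rw [hV, Matrix.mul_one, diagonal_mul_diagonal]
          congr 2
          ext i j
          by_cases hij : i = j
          · subst hij
            by_cases hi : i = ν
            · subst hi; simp
            · simp [hi]
          · simp [hij]
      _ = _ := by rw [Matrix.mul_smul, Matrix.smul_mul]
  have hfac : ∀ a : ℝ, cfc f (W * diagonal τ * Wᵀ) - f a • (1 : Matrix (Fin m) (Fin m) ℝ) =
      cfc (dslope f a) (W * diagonal τ * Wᵀ) *
        (W * diagonal τ * Wᵀ - a • (1 : Matrix (Fin m) (Fin m) ℝ)) := by
    intro a
    rw [cfc_conj_diagonal hW, cfc_conj_diagonal hW]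
    have hone : ∀ b : ℝ, b • (1 : Matrix (Fin m) (Fin m) ℝ) = W * diagonal (fun _ => b) * Wᵀ := by
      intro b
      have : (diagonal fun _ : Fin m => b) = b • (1 : Matrix (Fin m) (Fin m) ℝ) := by
        rw [smul_one_eq_diagonal]
      rw [this, Matrix.mul_smul, Matrix.smul_mul, Matrix.mul_one, hW']
    rw [hone, hone, ← Matrix.sub_mul, ← Matrix.mul_sub, diagonal_sub, ← Matrix.sub_mul,
      ← Matrix.mul_sub, diagonal_sub]
    calc W * diagonal (fun i => f (τ i) - f a) * Wᵀ
        = W * (diagonal (fun i => dslope f a (τ i)) * diagonal (fun i => τ i - a)) * Wᵀ := by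
          rw [diagonal_mul_diagonal]
          congr 3
          funext i
          rw [← sub_smul_dslope, smul_eq_mul, mul_comm]
      _ = W * (diagonal (fun i => dslope f a (τ i)) * (Wᵀ * W) * diagonal (fun i => τ i - a)) *
            Wᵀ := by rw [hW, Matrix.mul_one]
      _ = _ := by simp only [Matrix.mul_assoc]
  calc cfc f (W * diagonal τ * Wᵀ) - cfc f (V * diagonal t * Vᵀ)
      = ∑ ν, (cfc f (W * diagonal τ * Wᵀ) - cfc f (V * diagonal t * Vᵀ)) *
          (V * diagonal (Pi.single ν 1) * Vᵀ) := by
        rw [← Finset.mul_sum, hsum, Matrix.mul_one]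
    _ = _ := by
        refine Finset.sum_congr rfl fun ν _ => ?_
        have h1 : cfc f (V * diagonal t * Vᵀ) * (V * diagonal (Pi.single ν 1) * Vᵀ) =
            (f (t ν) • (1 : Matrix (Fin m) (Fin m) ℝ)) * (V * diagonal (Pi.single ν 1) * Vᵀ) := by
          rw [cfc_conj_diagonal hV, hproj, Matrix.smul_mul, Matrix.one_mul]
        have h2 : V * diagonal t * Vᵀ * (V * diagonal (Pi.single ν 1) * Vᵀ) =
            (t ν • (1 : Matrix (Fin m) (Fin m) ℝ)) * (V * diagonal (Pi.single ν 1) * Vᵀ) := by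
          rw [hproj, Matrix.smul_mul, Matrix.one_mul]
        rw [Matrix.sub_mul, h1, ← Matrix.sub_mul, hfac, Matrix.mul_assoc, Matrix.sub_mul, ← h2,
          ← Matrix.sub_mul, ← Matrix.mul_assoc]

theorem continuousOn_dslope_Ici {f : ℝ → ℝ} (hf : ContinuousOn f (Set.Ici 0)) {a : ℝ}
    (ha : DifferentiableAt ℝ f a) : ContinuousOn (dslope f a) (Set.Ici 0) := by
  intro b hb
  rcases eq_or_ne b a with rfl | hne
  · exact (continuousAt_dslope_same.mpr ha).continuousWithinAt
  · exact (continuousWithinAt_dslope_of_ne hne).mpr (hf b hb)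

/-- The Daletskii–Krein formula: the derivative of `f (Xᵀ X)` in the direction `E`. -/
theorem IsSVD.hasDerivAt_cfc_gram {n m : ℕ} (hmn : m ≤ n) {X U : Matrix (Fin n) (Fin m) ℝ}
    {s : Fin m → ℝ} {V : Matrix (Fin m) (Fin m) ℝ} (h : IsSVD X U s V) {f : ℝ → ℝ}
    (hf : ContinuousOn f (Set.Ici 0)) (hd : ∀ i, DifferentiableAt ℝ f (s i ^ 2))
    (E : Matrix (Fin n) (Fin m) ℝ) (k l : Fin m) :
    HasDerivAt (fun y : ℝ => cfc f ((X + y • E)ᵀ * (X + y • E)) k l)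
      (∑ μ, ∑ ν, dslope f (s ν ^ 2) (s μ ^ 2) * V k μ * V l ν *
        (Vᵀ * (Eᵀ * X + Xᵀ * E) * V) μ ν) 0 := by
  set P : Fin m → Matrix (Fin m) (Fin m) ℝ := fun ν => V * diagonal (Pi.single ν 1) * Vᵀ with hP
  let D : ℝ → Matrix (Fin m) (Fin m) ℝ := fun y => ∑ ν,
    cfc (dslope f (s ν ^ 2)) ((X + y • E)ᵀ * (X + y • E)) *
      (Eᵀ * X + Xᵀ * E + y • (Eᵀ * E)) * P ν
  have hcurve : Continuous fun y : ℝ => X + y • E :=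
    continuous_const.add (continuous_id.smul continuous_const)
  have hD : Continuous D := by
    refine continuous_finsetSum _ fun ν _ => ?_
    refine Continuous.matrix_mul (Continuous.matrix_mul ?_ ?_) continuous_const
    · exact (continuous_cfc_gram hmn (continuousOn_dslope_Ici hf (hd ν))).comp hcurve
    · exact continuous_const.add (continuous_id.smul continuous_const)
  have hdiff : ∀ y : ℝ, cfc f ((X + y • E)ᵀ * (X + y • E)) - cfc f (Xᵀ * X) = y • D y := by
    intro y
    obtain ⟨U', s', W, h'⟩ := exists_isSVD hmn (X + y • E)
    have key := cfc_sub_cfc h.right_orthonormal h'.right_orthonormal (fun i => s i ^ 2)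
      (fun i => s' i ^ 2) f
    rw [← h.gram_eq, ← h'.gram_eq] at key
    rw [key, Finset.smul_sum]
    refine Finset.sum_congr rfl fun ν _ => ?_
    rw [← Matrix.smul_mul, ← Matrix.mul_smul]
    congr 2
    simp only [transpose_add, transpose_smul, Matrix.add_mul, Matrix.mul_add, Matrix.smul_mul,
      Matrix.mul_smul, smul_add]
    abel
  have hval : D 0 k l = ∑ μ, ∑ ν, dslope f (s ν ^ 2) (s μ ^ 2) * V k μ * V l ν *
        (Vᵀ * (Eᵀ * X + Xᵀ * E) * V) μ ν := by
    simp only [D, zero_smul, add_zero, Matrix.sum_apply]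
    rw [Finset.sum_comm]
    refine Finset.sum_congr rfl fun ν _ => ?_
    rw [h.cfc_gram]
    have h1 : V * diagonal (fun i => dslope f (s ν ^ 2) (s i ^ 2)) * Vᵀ * (Eᵀ * X + Xᵀ * E) * P ν =
        V * (diagonal (fun i => dslope f (s ν ^ 2) (s i ^ 2)) *
          (Vᵀ * (Eᵀ * X + Xᵀ * E) * V)) * diagonal (Pi.single ν 1) * Vᵀ := by
      simp only [hP, Matrix.mul_assoc]
    rw [h1, conj_diagonal_apply, Finset.sum_eq_single ν (fun b _ hb => by simp [hb]) (by simp),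
      Matrix.mul_apply, Pi.single_eq_same, mul_one, Finset.sum_mul]
    refine Finset.sum_congr rfl fun μ _ => ?_
    rw [Matrix.diagonal_mul]
    ring
  rw [← hval, hasDerivAt_iff_tendsto_slope]
  have h3 : Tendsto (fun y => D y k l) (𝓝[≠] 0) (𝓝 (D 0 k l)) :=
    ((hD.matrix_elem k l).tendsto 0).mono_left nhdsWithin_le_nhds
  refine h3.congr' ?_
  filter_upwards [self_mem_nhdsWithin] with y hy
  have h4 := congrFun (congrFun (hdiff y) k) l
  rw [Matrix.sub_apply, Matrix.smul_apply, smul_eq_mul] at h4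
  rw [slope_def_field]
  simp only [zero_smul, add_zero, sub_zero]
  rw [h4, mul_div_cancel_left₀ _ hy]

/-! ### Scalar inequalities for powers and their divided differences -/

/-- Chebyshev's sum inequality with weights. -/
theorem weighted_chebyshev {ι : Type*} [Fintype ι] {w r h : ι → ℝ} (hw : ∀ i, 0 ≤ w i)
    (hrh : ∀ i j, 0 ≤ (r i - r j) * (h i - h j)) :
    (∑ i, w i * r i) * (∑ i, w i * h i) ≤ (∑ i, w i) * ∑ i, w i * (r i * h i) := by
  have h0 : 0 ≤ ∑ i, ∑ j, w i * w j * ((r i - r j) * (h i - h j)) :=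
    Finset.sum_nonneg fun i _ => Finset.sum_nonneg fun j _ =>
      mul_nonneg (mul_nonneg (hw i) (hw j)) (hrh i j)
  have h1 : ∑ i, ∑ j, w i * w j * ((r i - r j) * (h i - h j)) =
      2 * ((∑ i, w i) * ∑ i, w i * (r i * h i)) -
        2 * ((∑ i, w i * r i) * (∑ i, w i * h i)) := by
    have e : ∀ i j, w i * w j * ((r i - r j) * (h i - h j)) =
        (w i * (r i * h i)) * w j + w i * (w j * (r j * h j)) - (w i * r i) * (w j * h j) -
          (w i * h i) * (w j * r j) := fun i j => by ring
    simp only [e, Finset.sum_add_distrib, Finset.sum_sub_distrib, ← Finset.sum_mul_sum]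
    ring
  linarith

theorem dslope_comm {f : ℝ → ℝ} (a b : ℝ) : dslope f a b = dslope f b a := by
  rcases eq_or_ne a b with rfl | hab
  · rfl
  · rw [dslope_of_ne _ hab.symm, dslope_of_ne _ hab, slope_comm]

theorem dslope_comp_add_const (f : ℝ → ℝ) (ε a b : ℝ) :
    dslope (fun x => f (x + ε)) a b = dslope f (a + ε) (b + ε) := by
  rcases eq_or_ne b a with rfl | hab
  · rw [dslope_same, dslope_same, deriv_comp_add_const]
  · rw [dslope_of_ne _ hab, dslope_of_ne _ (by simpa using hab), slope_def_field, slope_def_field,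
      add_sub_add_right_eq_sub]

theorem dslope_rpow_same (a r : ℝ) :
    dslope (fun x : ℝ => x ^ r) a a = r * a ^ (r - 1) := by
  rw [dslope_same, Real.deriv_rpow_const]

theorem add_mul_dslope_rpow {a b : ℝ} (ha : 0 < a) (hb : 0 < b) (q : ℝ) :
    (a + b) * dslope (fun x : ℝ => x ^ (q - 1)) a b =
      2 * dslope (fun x : ℝ => x ^ q) a b - (a ^ (q - 1) + b ^ (q - 1)) := by
  rcases eq_or_ne b a with rfl | hab
  · rw [dslope_rpow_same, dslope_rpow_same, Real.rpow_sub_one hb.ne' (q - 1)]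
    field_simp
    ring
  · have h1 : b - a ≠ 0 := sub_ne_zero.mpr hab
    have hqa : a ^ q = a * a ^ (q - 1) := by rw [Real.rpow_sub_one ha.ne']; field_simp
    have hqb : b ^ q = b * b ^ (q - 1) := by rw [Real.rpow_sub_one hb.ne']; field_simp
    rw [dslope_of_ne _ hab, dslope_of_ne _ hab, slope_def_field, slope_def_field, hqa, hqb]
    field_simp
    ring

theorem dslope_rpow_nonneg {a b q : ℝ} (ha : 0 < a) (hb : 0 < b) (hq : 0 ≤ q) :
    0 ≤ dslope (fun x : ℝ => x ^ q) a b := by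
  rcases eq_or_ne b a with rfl | hab
  · rw [dslope_rpow_same]; positivity
  · rw [dslope_of_ne _ hab, slope_def_field]
    rcases lt_or_gt_of_ne hab with h | h
    · exact div_nonneg_of_nonpos (sub_nonpos.mpr (Real.rpow_le_rpow hb.le h.le hq))
        (sub_nonpos.mpr h.le)
    · exact div_nonneg (sub_nonneg.mpr (Real.rpow_le_rpow ha.le h.le hq)) (sub_nonneg.mpr h.le)

theorem dslope_rpow_nonpos {a b q : ℝ} (ha : 0 < a) (hb : 0 < b) (hq : q ≤ 0) :
    dslope (fun x : ℝ => x ^ q) a b ≤ 0 := by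
  rcases eq_or_ne b a with rfl | hab
  · rw [dslope_rpow_same]
    exact mul_nonpos_of_nonpos_of_nonneg hq (by positivity)
  · rw [dslope_of_ne _ hab, slope_def_field]
    rcases lt_or_gt_of_ne hab with h | h
    · exact div_nonpos_of_nonneg_of_nonpos
        (sub_nonneg.mpr (Real.rpow_le_rpow_of_nonpos hb h.le hq)) (sub_nonpos.mpr h.le)
    · exact div_nonpos_of_nonpos_of_nonneg
        (sub_nonpos.mpr (Real.rpow_le_rpow_of_nonpos ha h.le hq)) (sub_nonneg.mpr h.le)

/-- The trapezoidal rule underestimates the integral of the concave function `x ^ (p - 1)`. -/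
theorem trapezoid_le_rpow_sub_rpow {p a b : ℝ} (hp1 : 1 ≤ p) (hp2 : p ≤ 2) (hb : 0 < b)
    (hab : b ≤ a) :
    p / 2 * (a ^ (p - 1) + b ^ (p - 1)) * (a - b) ≤ a ^ p - b ^ p := by
  let H : ℝ → ℝ := fun x => x ^ p - b ^ p - p / 2 * (x ^ (p - 1) + b ^ (p - 1)) * (x - b)
  let H' : ℝ → ℝ := fun x => p * x ^ (p - 1) - (p / 2 * ((p - 1) * x ^ (p - 1 - 1)) * (x - b) +
    p / 2 * (x ^ (p - 1) + b ^ (p - 1)) * 1)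
  have hder : ∀ x, 0 < x → HasDerivAt H (H' x) x := by
    intro x hx
    refine ((Real.hasDerivAt_rpow_const (Or.inl hx.ne')).sub_const _).sub ?_
    exact (((Real.hasDerivAt_rpow_const (Or.inl hx.ne')).add_const _).const_mul _).mul
      ((hasDerivAt_id x).sub_const b)
  have hmono : MonotoneOn H (Set.Ici b) := by
    refine monotoneOn_of_deriv_nonneg (convex_Ici b)
      (fun x hx => (hder x (hb.trans_le hx)).continuousAt.continuousWithinAt)
      (fun x hx => ?_) (fun x hx => ?_)
    · rw [interior_Ici] at hx
      exact (hder x (hb.trans hx)).differentiableAt.differentiableWithinAt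
    · rw [interior_Ici] at hx
      have hx0 : 0 < x := hb.trans hx
      rw [(hder x hx0).deriv]
      -- the graph of `x ^ (p - 1)` lies below its tangent at `x`
      have htan : b ^ (p - 1) ≤ x ^ (p - 1) + (p - 1) * x ^ (p - 1 - 1) * (b - x) := by
        have h1 := rpow_one_add_le_one_add_mul_self (s := b / x - 1)
          (by have := div_pos hb hx0; linarith) (p := p - 1) (by linarith) (by linarith)
        rw [add_sub_cancel, Real.div_rpow hb.le hx0.le,
          div_le_iff₀ (Real.rpow_pos_of_pos hx0 _)] at h1
        refine h1.trans_eq ?_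
        rw [Real.rpow_sub_one hx0.ne' (p - 1)]
        field_simp
      simp only [H']
      nlinarith
  have h0 : H b ≤ H a := hmono Set.self_mem_Ici hab hab
  simp only [H, sub_self, mul_zero] at h0
  linarith

theorem le_dslope_rpow {a b q : ℝ} (ha : 0 < a) (hb : 0 < b) (hq1 : 1 / 2 ≤ q) (hq2 : q ≤ 1) :
    q * ((a ^ (2 * q - 1) + b ^ (2 * q - 1)) / (a ^ q + b ^ q)) ≤
      dslope (fun x : ℝ => x ^ q) a b := by
  have hlt : ∀ {a b : ℝ}, 0 < a → 0 < b → b < a →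
      q * ((a ^ (2 * q - 1) + b ^ (2 * q - 1)) / (a ^ q + b ^ q)) ≤
      dslope (fun x : ℝ => x ^ q) a b := by
    intro a b ha hb hab
    have h := trapezoid_le_rpow_sub_rpow (p := 2 * q) (by linarith) (by linarith) hb hab.le
    have hsq : ∀ {x : ℝ}, 0 < x → x ^ (2 * q) = (x ^ q) ^ 2 := fun hx => by
      rw [mul_comm, Real.rpow_mul hx.le, Real.rpow_two]
    have h2 : 0 < a ^ q + b ^ q := by positivity
    rw [dslope_comm, dslope_of_ne _ hab.ne', slope_def_field, le_div_iff₀ (sub_pos.mpr hab),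
      ← mul_div_assoc, div_mul_eq_mul_div, div_le_iff₀ h2]
    rw [hsq ha, hsq hb] at h
    linarith
  rcases lt_trichotomy a b with h | rfl | h
  · rw [dslope_comm, add_comm (a ^ _), add_comm (a ^ _)]
    exact hlt hb ha h
  · rw [dslope_rpow_same]
    have h1 : a ^ (2 * q - 1) = a ^ q * a ^ (q - 1) := by
      rw [← Real.rpow_add ha]; ring_nf
    have h2 : 0 < a ^ q := by positivity
    rw [h1]
    apply le_of_eq
    field_simp
  · exact hlt ha hb h

theorem card_mul_sum_rpow_le {m : ℕ} {t : Fin m → ℝ} (ht : ∀ i, 0 < t i) {q : ℝ} (hq0 : 0 ≤ q)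
    (hq : q ≤ 1) :
    m * ∑ i, t i ^ (2 * q - 1) ≤ (∑ i, t i ^ q) * ∑ i, t i ^ (q - 1) := by
  have h := weighted_chebyshev (w := fun i => t i ^ q) (r := fun i => t i ^ (q - 1))
    (h := fun i => t i ^ (-q)) (fun i => (Real.rpow_pos_of_pos (ht i) _).le) (fun i j => by
      rcases le_total (t i) (t j) with hij | hij
      · exact mul_nonneg
          (sub_nonneg.mpr (Real.rpow_le_rpow_of_nonpos (ht i) hij (by linarith)))
          (sub_nonneg.mpr (Real.rpow_le_rpow_of_nonpos (ht i) hij (by linarith)))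
      · exact mul_nonneg_of_nonpos_of_nonpos
          (sub_nonpos.mpr (Real.rpow_le_rpow_of_nonpos (ht j) hij (by linarith)))
          (sub_nonpos.mpr (Real.rpow_le_rpow_of_nonpos (ht j) hij (by linarith))))
  have e1 : ∀ i, t i ^ q * t i ^ (q - 1) = t i ^ (2 * q - 1) := fun i => by
    rw [← Real.rpow_add (ht i)]; ring_nf
  have e2 : ∀ i, t i ^ q * t i ^ (-q) = 1 := fun i => by
    rw [← Real.rpow_add (ht i), add_neg_cancel, Real.rpow_zero]
  have e3 : ∀ i, t i ^ q * (t i ^ (q - 1) * t i ^ (-q)) = t i ^ (q - 1) := fun i => by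
    rw [mul_left_comm, e2, mul_one]
  simp only [e1, e2, e3, Finset.sum_const, Finset.card_univ, Fintype.card_fin, nsmul_eq_mul,
    mul_one] at h
  linarith

/-- The off-diagonal divided differences dominate, by Chebyshev's inequality with weights `tᵢ ^ q`
for the decreasing functions `tᵢ ^ (q - 1)` and `∑_{j ≠ i} 1 / (tᵢ ^ q + tⱼ ^ q)` of `tᵢ`. -/
theorem mul_sum_rpow_le_sum_dslope {m : ℕ} {t : Fin m → ℝ} (ht : ∀ i, 0 < t i) {q : ℝ}
    (hq1 : 1 / 2 ≤ q) (hq2 : q ≤ 1) :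
    q * (m * (m - 1)) * ∑ i, t i ^ (2 * q - 1) ≤
      (∑ i, t i ^ q) * ∑ i, ∑ j ∈ Finset.univ.erase i, dslope (fun x : ℝ => x ^ q) (t i) (t j) := by
  set y : Fin m → ℝ := fun i => t i ^ q with hy
  set x : Fin m → ℝ := fun i => t i ^ (2 * q - 1) with hx
  set h : Fin m → ℝ := fun i => ∑ j ∈ Finset.univ.erase i, 1 / (y i + y j) with hh
  have hy0 : ∀ i, 0 < y i := fun i => Real.rpow_pos_of_pos (ht i) _
  have hanti : ∀ i k, t i ≤ t k → h k ≤ h i := by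
    intro i k hik
    have hyik : y i ≤ y k := Real.rpow_le_rpow (ht i).le hik (by linarith)
    have e : h k = ∑ j ∈ Finset.univ.erase i, 1 / (y k + y (Equiv.swap i k j)) := by
      refine (Finset.sum_equiv (Equiv.swap i k) (fun j => ?_) (fun j _ => rfl)).symm
      simp only [Finset.mem_erase, Finset.mem_univ, and_true, ne_eq]
      rw [not_iff_not, Equiv.swap_apply_eq_iff, Equiv.swap_apply_right]
    rw [e]
    refine Finset.sum_le_sum fun j hj => ?_
    have hji : j ≠ i := Finset.ne_of_mem_erase hj
    by_cases hjk : j = k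
    · subst hjk
      rw [Equiv.swap_apply_right, add_comm]
    · rw [Equiv.swap_apply_of_ne_of_ne hji hjk]
      exact one_div_le_one_div_of_le (add_pos (hy0 i) (hy0 j)) (by linarith)
  have hcheb := weighted_chebyshev (w := y) (r := fun i => t i ^ (q - 1)) (h := h)
    (fun i => (hy0 i).le) (fun i j => by
      rcases le_total (t i) (t j) with hij | hij
      · exact mul_nonneg
          (sub_nonneg.mpr (Real.rpow_le_rpow_of_nonpos (ht i) hij (by linarith)))
          (sub_nonneg.mpr (hanti _ _ hij))
      · exact mul_nonneg_of_nonpos_of_nonpos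
          (sub_nonpos.mpr (Real.rpow_le_rpow_of_nonpos (ht j) hij (by linarith)))
          (sub_nonpos.mpr (hanti _ _ hij)))
  have e1 : ∀ i, y i * t i ^ (q - 1) = x i := fun i => by
    simp only [hy, hx]
    rw [← Real.rpow_add (ht i)]; ring_nf
  have e2 : ∀ i, y i * (t i ^ (q - 1) * h i) = x i * h i := fun i => by rw [← mul_assoc, e1]
  simp only [e1, e2] at hcheb
  -- sums over ordered pairs of distinct indices are invariant under exchanging the indices
  have hswap : ∀ g : Fin m → Fin m → ℝ, ∑ i, ∑ j ∈ Finset.univ.erase i, g i j =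
      ∑ i, ∑ j ∈ Finset.univ.erase i, g j i := by
    intro g
    refine Finset.sum_comm' fun i j => ?_
    simp [eq_comm]
  have hyh : 2 * ∑ i, y i * h i = m * (m - 1) := by
    have e : ∑ i, y i * h i = ∑ i, ∑ j ∈ Finset.univ.erase i, y i / (y i + y j) := by
      refine Finset.sum_congr rfl fun i _ => ?_
      simp only [hh, Finset.mul_sum, mul_one_div]
    rw [two_mul]
    nth_rewrite 2 [e]
    rw [hswap, e, ← Finset.sum_add_distrib]
    have e' : ∀ i, ∑ j ∈ Finset.univ.erase i, y i / (y i + y j) +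
        ∑ j ∈ Finset.univ.erase i, y j / (y j + y i) = (m : ℝ) - 1 := by
      intro i
      rw [← Finset.sum_add_distrib]
      have : ∀ j, y i / (y i + y j) + y j / (y j + y i) = 1 := fun j => by
        rw [add_comm (y j), ← add_div, div_self (add_pos (hy0 i) (hy0 j)).ne']
      simp only [this, Finset.sum_const, Finset.card_erase_of_mem (Finset.mem_univ i),
        Finset.card_univ, Fintype.card_fin, nsmul_eq_mul, mul_one]
      rw [Nat.cast_sub (Nat.one_le_iff_ne_zero.mpr (Fin.pos i).ne'), Nat.cast_one]
    simp only [e', Finset.sum_const, Finset.card_univ, Fintype.card_fin, nsmul_eq_mul]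
  have hxh : ∑ i, ∑ j ∈ Finset.univ.erase i, (x i + x j) / (y i + y j) = 2 * ∑ i, x i * h i := by
    have e : ∑ i, x i * h i = ∑ i, ∑ j ∈ Finset.univ.erase i, x i / (y i + y j) := by
      refine Finset.sum_congr rfl fun i _ => ?_
      simp only [hh, Finset.mul_sum, mul_one_div]
    rw [two_mul]
    nth_rewrite 2 [e]
    rw [hswap (fun i j => x i / (y i + y j)), e, ← Finset.sum_add_distrib]
    refine Finset.sum_congr rfl fun i _ => ?_
    rw [← Finset.sum_add_distrib]
    refine Finset.sum_congr rfl fun j _ => ?_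
    rw [add_comm (y j), add_div]
  have hF : 0 ≤ ∑ i, y i := Finset.sum_nonneg fun i _ => (hy0 i).le
  have hq0 : 0 ≤ q := by linarith
  calc q * (m * (m - 1)) * ∑ i, x i = 2 * q * ((∑ i, x i) * ∑ i, y i * h i) := by
        rw [← hyh]; ring
    _ ≤ 2 * q * ((∑ i, y i) * ∑ i, x i * h i) := by gcongr
    _ = (∑ i, y i) * ∑ i, ∑ j ∈ Finset.univ.erase i, q * ((x i + x j) / (y i + y j)) := by
        simp only [← Finset.mul_sum, hxh]; ring
    _ ≤ _ := by
        refine mul_le_mul_of_nonneg_left ?_ hF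
        exact Finset.sum_le_sum fun i _ => Finset.sum_le_sum fun j _ =>
          le_dslope_rpow (ht i) (ht j) hq1 hq2

/-- The admissible range of the shrinkage constant. -/
def IsAdmissible (n m : ℕ) (p α : ℝ) : Prop :=
  0 ≤ α ∧ ((p ∈ Set.Icc (1 : ℝ) 2 ∧ α ≤ 2 * n * m - (2 - p) * m * (m + 1) - 2 * p) ∨
    (p ∈ Set.Ioo (0 : ℝ) 1 ∧ α ≤ 2 * n * m - 2 * m * (m + 1) + 2 * (m - 1) * p))

theorem IsAdmissible.pos {n m : ℕ} {p α : ℝ} (h : IsAdmissible n m p α) : 0 < p := by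
  rcases h.2 with h | h
  · linarith [h.1.1]
  · exact h.1.1

theorem IsAdmissible.le_two {n m : ℕ} {p α : ℝ} (h : IsAdmissible n m p α) : p ≤ 2 := by
  rcases h.2 with h | h
  · exact h.1.2
  · linarith [h.1.2]

theorem IsAdmissible.mul_sum_rpow_le {n m : ℕ} (hmn : m ≤ n) {q α : ℝ}
    (h : IsAdmissible n m (2 * q) α) {t : Fin m → ℝ} (ht : ∀ i, 0 < t i) :
    (α + 4 * q) * ∑ i, t i ^ (2 * q - 1) ≤
      2 * (∑ i, t i ^ q) * ((n - m + (2 * q - 1)) * ∑ i, t i ^ (q - 1) +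
        ∑ i, ∑ j ∈ Finset.univ.erase i, dslope (fun x : ℝ => x ^ q) (t i) (t j)) := by
  have hq0 : 0 < q := by linarith [h.pos]
  have hq1 : q ≤ 1 := by linarith [h.le_two]
  have hcheb := card_mul_sum_rpow_le ht hq0.le hq1
  have hmn' : (m : ℝ) ≤ n := by exact_mod_cast hmn
  set A := ∑ i, t i ^ (2 * q - 1)
  set F := ∑ i, t i ^ q
  set B := ∑ i, t i ^ (q - 1)
  have hA : 0 ≤ A := Finset.sum_nonneg fun i _ => (Real.rpow_pos_of_pos (ht i) _).le
  have hF : 0 ≤ F := Finset.sum_nonneg fun i _ => (Real.rpow_pos_of_pos (ht i) _).le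
  obtain ⟨hα, ⟨hp, hle⟩ | ⟨hp, hle⟩⟩ := h
  · have hpair := mul_sum_rpow_le_sum_dslope ht (q := q) (by linarith [hp.1]) hq1
    have hc : 0 ≤ (n : ℝ) - m + (2 * q - 1) := by linarith [hp.1]
    have h1 := mul_le_mul_of_nonneg_left hcheb hc
    have h2 : (α + 4 * q) * A ≤
        (2 * (n - m + (2 * q - 1)) * m + 2 * (q * (m * (m - 1)))) * A :=
      mul_le_mul_of_nonneg_right (by linarith) hA
    linarith
  · have hoff : 0 ≤ ∑ i, ∑ j ∈ Finset.univ.erase i, dslope (fun x : ℝ => x ^ q) (t i) (t j) :=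
      Finset.sum_nonneg fun i _ => Finset.sum_nonneg fun j _ =>
        dslope_rpow_nonneg (ht i) (ht j) hq0.le
    have hle' : α + 4 * q ≤ 2 * (m * (n - m + (2 * q - 1))) := by linarith
    -- `α + 4 q` is positive, so the upper bound on it is
    have hc : 0 ≤ (n : ℝ) - m + (2 * q - 1) := by
      by_contra hneg
      have : (m : ℝ) * (n - m + (2 * q - 1)) ≤ 0 :=
        mul_nonpos_of_nonneg_of_nonpos (Nat.cast_nonneg m) (not_le.mp hneg).le
      linarith
    have h1 := mul_le_mul_of_nonneg_left hcheb hc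
    have h2 := mul_le_mul_of_nonneg_right hle' hA
    have h3 := mul_nonneg hF hoff
    linarith

/-- The inequality that makes Stein's unbiased estimate of the risk of the smoothed estimator at
most `n m`. The right-hand side is, up to the factor `2 ∑ tᵢ ^ q`, the divergence of
`X ↦ X (Xᵀ X + ε) ^ (q - 1)`. -/
theorem IsAdmissible.unbiased_risk_le {n m : ℕ} (hmn : m ≤ n) {q α ε : ℝ}
    (h : IsAdmissible n m (2 * q) α) (hε : 0 < ε) {s t : Fin m → ℝ}
    (hst : ∀ i, t i = s i ^ 2 + ε) :
    (α + 4 * q) * ∑ i, (s i * t i ^ (q - 1)) ^ 2 ≤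
      2 * (∑ i, t i ^ q) * (n * ∑ i, t i ^ (q - 1) +
        ∑ μ, s μ ^ 2 * dslope (fun x : ℝ => x ^ (q - 1)) (t μ) (t μ) +
        ∑ μ, ∑ ν, s μ ^ 2 * dslope (fun x : ℝ => x ^ (q - 1)) (t ν) (t μ)) := by
  have hq0 : 0 < q := by linarith [h.pos]
  have hq1 : q ≤ 1 := by linarith [h.le_two]
  have hα := h.1
  have ht : ∀ i, 0 < t i := fun i => by rw [hst]; positivity
  have hs : ∀ i, s i ^ 2 ≤ t i := fun i => by rw [hst]; linarith
  have hF : 0 ≤ ∑ i, t i ^ q := Finset.sum_nonneg fun i _ => (Real.rpow_pos_of_pos (ht i) _).le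
  have hA : ∑ i, (s i * t i ^ (q - 1)) ^ 2 ≤ ∑ i, t i ^ (2 * q - 1) := by
    refine Finset.sum_le_sum fun i _ => ?_
    have e : t i ^ (2 * q - 1) = t i * (t i ^ (q - 1)) ^ 2 := by
      rw [← Real.rpow_natCast, ← Real.rpow_mul (ht i).le]
      nth_rewrite 2 [← Real.rpow_one (t i)]
      rw [← Real.rpow_add (ht i)]
      push_cast
      ring_nf
    rw [e, mul_pow]
    exact mul_le_mul_of_nonneg_right (hs i) (sq_nonneg _)
  have hΔ : ∀ μ ν, t μ * dslope (fun x : ℝ => x ^ (q - 1)) (t ν) (t μ) ≤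
      s μ ^ 2 * dslope (fun x : ℝ => x ^ (q - 1)) (t ν) (t μ) := fun μ ν =>
    mul_le_mul_of_nonpos_right (hs μ) (dslope_rpow_nonpos (ht ν) (ht μ) (by linarith))
  have hdiag : ∑ μ, t μ * dslope (fun x : ℝ => x ^ (q - 1)) (t μ) (t μ) =
      (q - 1) * ∑ i, t i ^ (q - 1) := by
    rw [Finset.mul_sum]
    refine Finset.sum_congr rfl fun μ _ => ?_
    rw [dslope_rpow_same, Real.rpow_sub_one (ht μ).ne' (q - 1)]
    have := (ht μ).ne'
    field_simp
  have hoff : ∑ μ, ∑ ν, t μ * dslope (fun x : ℝ => x ^ (q - 1)) (t ν) (t μ) =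
      (q - m) * ∑ i, t i ^ (q - 1) +
        ∑ i, ∑ j ∈ Finset.univ.erase i, dslope (fun x : ℝ => x ^ q) (t i) (t j) := by
    have e1 : ∑ μ, ∑ ν, t μ * dslope (fun x : ℝ => x ^ (q - 1)) (t ν) (t μ) =
        ∑ μ, ∑ ν, t ν * dslope (fun x : ℝ => x ^ (q - 1)) (t ν) (t μ) := by
      rw [Finset.sum_comm]
      refine Finset.sum_congr rfl fun μ _ => Finset.sum_congr rfl fun ν _ => ?_
      rw [dslope_comm]
    have e2 : 2 * ∑ μ, ∑ ν, t μ * dslope (fun x : ℝ => x ^ (q - 1)) (t ν) (t μ) =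
        ∑ μ, ∑ ν, (2 * dslope (fun x : ℝ => x ^ q) (t μ) (t ν) -
          (t μ ^ (q - 1) + t ν ^ (q - 1))) := by
      rw [two_mul]
      nth_rewrite 2 [e1]
      rw [← Finset.sum_add_distrib]
      refine Finset.sum_congr rfl fun μ _ => ?_
      rw [← Finset.sum_add_distrib]
      refine Finset.sum_congr rfl fun ν _ => ?_
      rw [← add_mul, dslope_comm, add_mul_dslope_rpow (ht μ) (ht ν)]
    have e3 : ∑ μ, ∑ ν, dslope (fun x : ℝ => x ^ q) (t μ) (t ν) =
        q * ∑ i, t i ^ (q - 1) +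
          ∑ i, ∑ j ∈ Finset.univ.erase i, dslope (fun x : ℝ => x ^ q) (t i) (t j) := by
      rw [Finset.mul_sum, ← Finset.sum_add_distrib]
      refine Finset.sum_congr rfl fun i _ => ?_
      rw [← Finset.add_sum_erase _ _ (Finset.mem_univ i), dslope_rpow_same]
    have e4 : ∑ μ, ∑ ν, (2 * dslope (fun x : ℝ => x ^ q) (t μ) (t ν) -
          (t μ ^ (q - 1) + t ν ^ (q - 1))) =
        2 * (∑ μ, ∑ ν, dslope (fun x : ℝ => x ^ q) (t μ) (t ν)) -
          2 * (m * ∑ i, t i ^ (q - 1)) := by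
      simp only [Finset.sum_sub_distrib, Finset.sum_add_distrib, ← Finset.mul_sum,
        Finset.sum_const, Finset.card_univ, Fintype.card_fin, nsmul_eq_mul]
      ring
    linarith
  have key := h.mul_sum_rpow_le hmn ht
  have h1 := Finset.sum_le_sum fun μ (_ : μ ∈ Finset.univ) => hΔ μ μ
  have h2 := Finset.sum_le_sum fun μ (_ : μ ∈ Finset.univ) =>
    Finset.sum_le_sum fun ν (_ : ν ∈ Finset.univ) => hΔ μ ν
  calc (α + 4 * q) * ∑ i, (s i * t i ^ (q - 1)) ^ 2
      ≤ (α + 4 * q) * ∑ i, t i ^ (2 * q - 1) := mul_le_mul_of_nonneg_left hA (by linarith)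
    _ ≤ _ := key
    _ ≤ _ := by
        refine mul_le_mul_of_nonneg_left ?_ (by linarith)
        rw [hdiag] at h1
        rw [hoff] at h2
        linarith

/-! ### The smoothed shrinkage field and its divergence -/

/-- The matrix power `(Xᵀ X + ε) ^ r`. -/
noncomputable def gramPow {n m : ℕ} (r ε : ℝ) (X : Matrix (Fin n) (Fin m) ℝ) :
    Matrix (Fin m) (Fin m) ℝ :=
  cfc (fun x : ℝ => (x + ε) ^ r) (Xᵀ * X)

/-- The smoothed shrinkage field
`-α X (Xᵀ X + ε) ^ (q - 1) / tr (Xᵀ X + ε) ^ q`, which is `-α / (2 q)` times the gradient of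
`log tr (Xᵀ X + ε) ^ q`. For `ε = 0` and `q = p / 2` it is the correction that
`normShrinkageEstimator p α` adds to `X`. -/
noncomputable def smoothField {n m : ℕ} (q α ε : ℝ) (X : Matrix (Fin n) (Fin m) ℝ) :
    Matrix (Fin n) (Fin m) ℝ :=
  (-α / (gramPow q ε X).trace) • (X * gramPow (q - 1) ε X)

theorem continuousOn_add_rpow {ε : ℝ} (hε : 0 < ε) (r : ℝ) :
    ContinuousOn (fun x : ℝ => (x + ε) ^ r) (Set.Ici 0) := fun _ hx =>
  ((continuousAt_id.add continuousAt_const).rpow_const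
    (Or.inl (add_pos_of_nonneg_of_pos hx hε).ne')).continuousWithinAt

theorem differentiableAt_add_rpow {ε : ℝ} (hε : 0 < ε) (r s : ℝ) :
    DifferentiableAt ℝ (fun x : ℝ => (x + ε) ^ r) (s ^ 2) :=
  (differentiableAt_id.add_const ε).rpow_const (Or.inl (by simp only [id]; positivity))

theorem continuous_gramPow {n m : ℕ} (hmn : m ≤ n) {ε : ℝ} (hε : 0 < ε) (r : ℝ) :
    Continuous (gramPow r ε : Matrix (Fin n) (Fin m) ℝ → _) :=
  continuous_cfc_gram hmn (continuousOn_add_rpow hε r)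

section SVD

variable {n m : ℕ} {X U : Matrix (Fin n) (Fin m) ℝ} {s : Fin m → ℝ}
  {V : Matrix (Fin m) (Fin m) ℝ}

theorem IsSVD.gramPow_eq (h : IsSVD X U s V) (r ε : ℝ) :
    gramPow r ε X = V * diagonal (fun i => (s i ^ 2 + ε) ^ r) * Vᵀ :=
  h.cfc_gram _

theorem IsSVD.trace_gramPow (h : IsSVD X U s V) (r ε : ℝ) :
    (gramPow r ε X).trace = ∑ i, (s i ^ 2 + ε) ^ r := by
  rw [h.gramPow_eq, Matrix.trace_mul_comm, ← Matrix.mul_assoc, h.right_orthonormal,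
    Matrix.one_mul, Matrix.trace_diagonal]

theorem IsSVD.mul_gramPow (h : IsSVD X U s V) (r ε : ℝ) :
    X * gramPow r ε X = U * diagonal (fun i => s i * (s i ^ 2 + ε) ^ r) * Vᵀ := by
  rw [h.gramPow_eq, ← Matrix.mul_assoc, ← Matrix.mul_assoc, h.mul_right, Matrix.mul_assoc U,
    diagonal_mul_diagonal]

theorem IsSVD.smoothField_eq (h : IsSVD X U s V) (q α ε : ℝ) :
    smoothField q α ε X = U * diagonal (fun i =>
      -α / (∑ j, (s j ^ 2 + ε) ^ q) * (s i * (s i ^ 2 + ε) ^ (q - 1))) * Vᵀ := by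
  rw [smoothField, h.trace_gramPow, h.mul_gramPow, ← Matrix.smul_mul, ← Matrix.mul_smul]
  congr 2
  ext i j
  by_cases hij : i = j <;> simp [hij]

theorem trace_gramPow_pos (hmn : m ≤ n) (X : Matrix (Fin n) (Fin m) ℝ) {ε : ℝ} (hε : 0 < ε)
    (r : ℝ) (j : Fin m) : 0 < (gramPow r ε X).trace := by
  obtain ⟨U, s, V, h⟩ := exists_isSVD hmn X
  rw [h.trace_gramPow]
  exact Finset.sum_pos (fun i _ => by positivity) ⟨j, Finset.mem_univ j⟩

theorem continuous_smoothField (hmn : m ≤ n) {ε : ℝ} (hε : 0 < ε) (q α : ℝ) :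
    Continuous (smoothField q α ε : Matrix (Fin n) (Fin m) ℝ → _) := by
  refine continuous_matrix fun i j => ?_
  have h1 : Continuous fun X : Matrix (Fin n) (Fin m) ℝ => (gramPow q ε X).trace :=
    (continuous_gramPow hmn hε q).matrix_trace
  have h2 : Continuous fun X : Matrix (Fin n) (Fin m) ℝ => (X * gramPow (q - 1) ε X) i j :=
    (continuous_id.matrix_mul (continuous_gramPow hmn hε (q - 1))).matrix_elem i j
  exact (continuous_const.div h1 fun X => (trace_gramPow_pos hmn X hε q j).ne').mul h2

theorem IsSVD.orthonormal_left (h : IsSVD X U s V) (μ ν : Fin m) :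
    ∑ i, U i μ * U i ν = if μ = ν then 1 else 0 := by
  have := congrFun (congrFun h.left_orthonormal μ) ν
  rwa [Matrix.mul_apply, Matrix.one_apply] at this

theorem IsSVD.orthonormal_right (h : IsSVD X U s V) (μ ν : Fin m) :
    ∑ i, V i μ * V i ν = if μ = ν then 1 else 0 := by
  have := congrFun (congrFun h.right_orthonormal μ) ν
  rwa [Matrix.mul_apply, Matrix.one_apply] at this

theorem IsSVD.abs_left_le (h : IsSVD X U s V) (i : Fin n) (μ : Fin m) : |U i μ| ≤ 1 := by
  have h1 := h.orthonormal_left μ μ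
  rw [if_pos rfl] at h1
  have h2 : U i μ * U i μ ≤ ∑ k, U k μ * U k μ :=
    Finset.single_le_sum (f := fun k => U k μ * U k μ) (fun k _ => mul_self_nonneg _)
      (Finset.mem_univ i)
  rw [h1] at h2
  exact abs_le_one_iff_mul_self_le_one.mpr h2

theorem IsSVD.abs_right_le (h : IsSVD X U s V) (i μ : Fin m) : |V i μ| ≤ 1 := by
  have h1 := h.orthonormal_right μ μ
  rw [if_pos rfl] at h1
  have h2 : V i μ * V i μ ≤ ∑ k, V k μ * V k μ :=
    Finset.single_le_sum (f := fun k => V k μ * V k μ) (fun k _ => mul_self_nonneg _)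
      (Finset.mem_univ i)
  rw [h1] at h2
  exact abs_le_one_iff_mul_self_le_one.mpr h2

/-- The variation of the Gram matrix along a coordinate direction, in the singular basis. -/
theorem IsSVD.gram_variation (h : IsSVD X U s V) (i : Fin n) (j μ ν : Fin m) :
    (Vᵀ * ((single i j (1 : ℝ))ᵀ * X + Xᵀ * single i j (1 : ℝ)) * V) μ ν =
      V j μ * (U i ν * s ν) + U i μ * s μ * V j ν := by
  have hE : ∀ (k : Fin n) κ, (single i j (1 : ℝ) * V) k κ = if k = i then V j κ else 0 := by
    intro k κ
    by_cases hk : k = i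
    · subst hk; simp
    · simp [hk]
  have h1 : Vᵀ * ((single i j (1 : ℝ))ᵀ * X + Xᵀ * single i j (1 : ℝ)) * V =
      (single i j (1 : ℝ) * V)ᵀ * (X * V) + (X * V)ᵀ * (single i j (1 : ℝ) * V) := by
    simp only [transpose_mul, Matrix.mul_add, Matrix.add_mul, Matrix.mul_assoc]
  rw [h1, Matrix.add_apply, Matrix.mul_apply, Matrix.mul_apply, h.mul_right]
  simp only [transpose_apply, hE, Matrix.mul_diagonal]
  simp

theorem dslope_add_rpow (r ε a b : ℝ) :
    dslope (fun x : ℝ => (x + ε) ^ r) a b = dslope (fun x : ℝ => x ^ r) (a + ε) (b + ε) :=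
  dslope_comp_add_const (fun x => x ^ r) ε a b

theorem IsSVD.hasDerivAt_trace_gramPow (hmn : m ≤ n) (h : IsSVD X U s V) {ε : ℝ} (hε : 0 < ε)
    (q : ℝ) (i : Fin n) (j : Fin m) :
    HasDerivAt (fun y : ℝ => (gramPow q ε (X + y • single i j (1 : ℝ))).trace)
      (2 * q * (X * gramPow (q - 1) ε X) i j) 0 := by
  have h1 : HasDerivAt (fun y : ℝ => (gramPow q ε (X + y • single i j (1 : ℝ))).trace)
      (∑ k, _) 0 := HasDerivAt.fun_sum fun k _ =>
    h.hasDerivAt_cfc_gram hmn (continuousOn_add_rpow hε q)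
      (fun i => differentiableAt_add_rpow hε q (s i)) (single i j (1 : ℝ)) k k
  convert h1 using 1
  have e : ∀ μ ν, ∑ k, dslope (fun x : ℝ => (x + ε) ^ q) (s ν ^ 2) (s μ ^ 2) * V k μ * V k ν *
      (Vᵀ * ((single i j (1 : ℝ))ᵀ * X + Xᵀ * single i j (1 : ℝ)) * V) μ ν =
      if μ = ν then 2 * q * (U i μ * (s μ * (s μ ^ 2 + ε) ^ (q - 1)) * V j μ) else 0 := by
    intro μ ν
    rw [h.gram_variation]
    rw [← Finset.sum_mul]
    simp only [mul_assoc (dslope _ _ _)]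
    rw [← Finset.mul_sum, h.orthonormal_right]
    split_ifs with hμν
    · subst hμν
      rw [dslope_add_rpow, dslope_rpow_same]
      ring
    · simp
  rw [h.mul_gramPow, conj_diagonal_apply, Finset.sum_comm, Finset.mul_sum]
  refine Finset.sum_congr rfl fun μ _ => ?_
  rw [Finset.sum_comm]
  simp only [e]
  simp

/-- The partial derivative of the `(i, j)` entry of `X (Xᵀ X + ε) ^ (q - 1)` in the direction of
that entry. -/
noncomputable def partialGramPow (q ε : ℝ) (U : Matrix (Fin n) (Fin m) ℝ) (s : Fin m → ℝ)
    (V : Matrix (Fin m) (Fin m) ℝ) (i : Fin n) (j : Fin m) : ℝ :=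
  ∑ μ, V j μ * (s μ ^ 2 + ε) ^ (q - 1) * V j μ +
    ∑ μ, ∑ ν, dslope (fun x : ℝ => x ^ (q - 1)) (s ν ^ 2 + ε) (s μ ^ 2 + ε) *
      (U i μ * s μ * V j ν * (V j μ * (U i ν * s ν) + U i μ * s μ * V j ν))

theorem IsSVD.hasDerivAt_mul_gramPow (hmn : m ≤ n) (h : IsSVD X U s V) {ε : ℝ} (hε : 0 < ε)
    (q : ℝ) (i : Fin n) (j : Fin m) :
    HasDerivAt (fun y : ℝ => ((X + y • single i j (1 : ℝ)) *
      gramPow (q - 1) ε (X + y • single i j (1 : ℝ))) i j) (partialGramPow q ε U s V i j) 0 := by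
  have hX : ∀ k, HasDerivAt (fun y : ℝ => (X + y • single i j (1 : ℝ)) i k)
      (if k = j then 1 else 0) 0 := by
    intro k
    have h1 : (fun y : ℝ => (X + y • single i j (1 : ℝ)) i k) =
        fun y => X i k + y * (if k = j then 1 else 0) := by
      funext y
      by_cases hk : k = j
      · subst hk; simp
      · simp [hk, Ne.symm hk]
    rw [h1]
    simpa using ((hasDerivAt_id (0 : ℝ)).mul_const (if k = j then (1 : ℝ) else 0)).const_add (X i k)
  have hK := fun k => h.hasDerivAt_cfc_gram hmn (continuousOn_add_rpow hε (q - 1))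
    (fun i => differentiableAt_add_rpow hε (q - 1) (s i)) (single i j (1 : ℝ)) k j
  have h1 := HasDerivAt.fun_sum (u := Finset.univ) fun k _ => (hX k).mul (hK k)
  have h2 : (fun y : ℝ => ((X + y • single i j (1 : ℝ)) *
      gramPow (q - 1) ε (X + y • single i j (1 : ℝ))) i j) = fun y => ∑ k,
      (X + y • single i j (1 : ℝ)) i k * gramPow (q - 1) ε (X + y • single i j (1 : ℝ)) k j := by
    funext y
    rw [Matrix.mul_apply]
  rw [h2]
  refine h1.congr_deriv ?_
  simp only [zero_smul, add_zero, h.gram_variation, dslope_add_rpow, h.cfc_gram,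
    conj_diagonal_apply]
  rw [Finset.sum_add_distrib, partialGramPow]
  congr 1
  · simp
  · have hXV : ∀ μ, ∑ k, X i k * V k μ = U i μ * s μ := by
      intro μ
      have := congrFun (congrFun h.mul_right i) μ
      rwa [Matrix.mul_apply, Matrix.mul_diagonal] at this
    simp only [Finset.mul_sum]
    rw [Finset.sum_comm]
    refine Finset.sum_congr rfl fun μ _ => ?_
    rw [Finset.sum_comm]
    refine Finset.sum_congr rfl fun ν _ => ?_
    rw [← hXV μ, Finset.sum_mul, Finset.sum_mul, Finset.mul_sum]
    refine Finset.sum_congr rfl fun k _ => ?_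
    ring

/-- The divergence of `X (Xᵀ X + ε) ^ (q - 1)`, in terms of the singular values. -/
theorem IsSVD.sum_partialGramPow (h : IsSVD X U s V) (q ε : ℝ) :
    ∑ i, ∑ j, partialGramPow q ε U s V i j =
      n * ∑ μ, (s μ ^ 2 + ε) ^ (q - 1) +
        ∑ μ, s μ ^ 2 * dslope (fun x : ℝ => x ^ (q - 1)) (s μ ^ 2 + ε) (s μ ^ 2 + ε) +
        ∑ μ, ∑ ν, s μ ^ 2 * dslope (fun x : ℝ => x ^ (q - 1)) (s ν ^ 2 + ε) (s μ ^ 2 + ε) := by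
  have h1 : ∑ j, ∑ μ, V j μ * (s μ ^ 2 + ε) ^ (q - 1) * V j μ = ∑ μ, (s μ ^ 2 + ε) ^ (q - 1) := by
    rw [Finset.sum_comm]
    refine Finset.sum_congr rfl fun μ _ => ?_
    have := h.orthonormal_right μ μ
    rw [if_pos rfl] at this
    calc ∑ j, V j μ * (s μ ^ 2 + ε) ^ (q - 1) * V j μ
        = (s μ ^ 2 + ε) ^ (q - 1) * ∑ j, V j μ * V j μ := by
          rw [Finset.mul_sum]; exact Finset.sum_congr rfl fun j _ => by ring
      _ = _ := by rw [this, mul_one]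
  have h2 : ∀ μ ν (Δ : ℝ), ∑ i, ∑ j, Δ *
      (U i μ * s μ * V j ν * (V j μ * (U i ν * s ν) + U i μ * s μ * V j ν)) =
      (if μ = ν then s μ ^ 2 * Δ else 0) + s μ ^ 2 * Δ := by
    intro μ ν Δ
    have e : ∀ i j, Δ * (U i μ * s μ * V j ν * (V j μ * (U i ν * s ν) + U i μ * s μ * V j ν)) =
        Δ * s μ * s ν * ((U i μ * U i ν) * (V j μ * V j ν)) +
          Δ * s μ ^ 2 * ((U i μ * U i μ) * (V j ν * V j ν)) := fun i j => by ring
    simp only [e, Finset.sum_add_distrib, ← Finset.mul_sum, ← Finset.sum_mul,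
      h.orthonormal_left, h.orthonormal_right, if_true]
    split_ifs with hμν
    · subst hμν; ring
    · ring
  simp only [partialGramPow, Finset.sum_add_distrib, h1]
  rw [add_assoc]
  congr 1
  · simp
  · calc ∑ i, ∑ j, ∑ μ, ∑ ν, dslope (fun x : ℝ => x ^ (q - 1)) (s ν ^ 2 + ε) (s μ ^ 2 + ε) *
          (U i μ * s μ * V j ν * (V j μ * (U i ν * s ν) + U i μ * s μ * V j ν))
        = ∑ μ, ∑ ν, ∑ i, ∑ j, dslope (fun x : ℝ => x ^ (q - 1)) (s ν ^ 2 + ε) (s μ ^ 2 + ε) *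
          (U i μ * s μ * V j ν * (V j μ * (U i ν * s ν) + U i μ * s μ * V j ν)) := by
          rw [Finset.sum_congr rfl fun i _ => Finset.sum_comm, Finset.sum_comm]
          refine Finset.sum_congr rfl fun μ _ => ?_
          rw [Finset.sum_congr rfl fun i _ => Finset.sum_comm, Finset.sum_comm]
      _ = _ := by
          simp only [h2, Finset.sum_add_distrib]
          simp

theorem IsSVD.sum_sq_mul_gramPow (h : IsSVD X U s V) (r ε : ℝ) :
    ∑ i, ∑ j, (X * gramPow r ε X) i j ^ 2 = ∑ μ, (s μ * (s μ ^ 2 + ε) ^ r) ^ 2 := by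
  set c : Fin m → ℝ := fun μ => s μ * (s μ ^ 2 + ε) ^ r
  have h1 : ∑ i, ∑ j, (X * gramPow r ε X) i j ^ 2 =
      ((X * gramPow r ε X)ᵀ * (X * gramPow r ε X)).trace := by
    rw [Finset.sum_comm]
    rw [Matrix.trace]
    refine Finset.sum_congr rfl fun j _ => ?_
    rw [Matrix.diag_apply, Matrix.mul_apply (M := (X * gramPow r ε X)ᵀ)]
    simp only [transpose_apply, sq]
  rw [h1, h.mul_gramPow]
  have h2 : (U * diagonal c * Vᵀ)ᵀ * (U * diagonal c * Vᵀ) =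
      V * diagonal (fun μ => c μ ^ 2) * Vᵀ := by
    simp only [transpose_mul, transpose_transpose, diagonal_transpose]
    calc V * (diagonal c * Uᵀ) * (U * diagonal c * Vᵀ)
        = V * (diagonal c * (Uᵀ * U) * diagonal c) * Vᵀ := by simp only [Matrix.mul_assoc]
      _ = _ := by
        rw [h.left_orthonormal, Matrix.mul_one, diagonal_mul_diagonal]
        simp only [sq]
  rw [h2, Matrix.trace_mul_comm, ← Matrix.mul_assoc, h.right_orthonormal, Matrix.one_mul,
    Matrix.trace_diagonal]

theorem IsSVD.abs_mul_gramPow_le (h : IsSVD X U s V) {ε : ℝ} (hε : 0 < ε) (q : ℝ) (i : Fin n)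
    (j : Fin m) :
    |(X * gramPow (q - 1) ε X) i j| ≤ (1 + 1 / ε) * (gramPow q ε X).trace := by
  rw [h.mul_gramPow, h.trace_gramPow, conj_diagonal_apply, Finset.mul_sum]
  refine (Finset.abs_sum_le_sum_abs _ _).trans (Finset.sum_le_sum fun μ _ => ?_)
  have ht : 0 < s μ ^ 2 + ε := by positivity
  have h1 : s μ ≤ (1 + 1 / ε) * (s μ ^ 2 + ε) := by
    have e : (1 + 1 / ε) * (s μ ^ 2 + ε) = s μ ^ 2 + ε + s μ ^ 2 / ε + 1 := by field_simp; ring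
    have h0 : 0 ≤ s μ ^ 2 / ε := by positivity
    rw [e]
    nlinarith [sq_nonneg (s μ - 1)]
  have h2 : (s μ ^ 2 + ε) ^ q = (s μ ^ 2 + ε) * (s μ ^ 2 + ε) ^ (q - 1) := by
    rw [Real.rpow_sub_one ht.ne']; field_simp
  have h3 : 0 ≤ s μ * (s μ ^ 2 + ε) ^ (q - 1) := mul_nonneg (h.nonneg μ) (by positivity)
  calc |U i μ * (s μ * (s μ ^ 2 + ε) ^ (q - 1)) * V j μ|
      = |U i μ| * (s μ * (s μ ^ 2 + ε) ^ (q - 1)) * |V j μ| := by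
        rw [abs_mul, abs_mul, abs_of_nonneg h3]
    _ ≤ 1 * (s μ * (s μ ^ 2 + ε) ^ (q - 1)) * 1 := by
        gcongr
        · exact h.abs_left_le i μ
        · exact h.abs_right_le j μ
    _ ≤ (1 + 1 / ε) * (s μ ^ 2 + ε) ^ q := by
        rw [h2, one_mul, mul_one, ← mul_assoc]
        exact mul_le_mul_of_nonneg_right h1 (by positivity)

theorem IsSVD.abs_partialGramPow_le (h : IsSVD X U s V) {ε q : ℝ} (hε : 0 < ε) (hq0 : 0 ≤ q)
    (hq1 : q ≤ 1) (i : Fin n) (j : Fin m) :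
    |partialGramPow q ε U s V i j| ≤ (1 + 4 * m) / ε * (gramPow q ε X).trace := by
  have ht : ∀ μ, 0 < s μ ^ 2 + ε := fun μ => by positivity
  have hr : ∀ μ, 0 < (s μ ^ 2 + ε) ^ (q - 1) := fun μ => Real.rpow_pos_of_pos (ht μ) _
  set B := ∑ μ, (s μ ^ 2 + ε) ^ (q - 1)
  have hB : B ≤ (gramPow q ε X).trace / ε := by
    rw [h.trace_gramPow, Finset.sum_div]
    refine Finset.sum_le_sum fun μ _ => ?_
    rw [le_div_iff₀ hε, Real.rpow_sub_one (ht μ).ne', div_mul_eq_mul_div, div_le_iff₀ (ht μ)]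
    exact mul_le_mul_of_nonneg_left (by linarith [sq_nonneg (s μ)]) (by have := ht μ; positivity)
  have h1 : |∑ μ, V j μ * (s μ ^ 2 + ε) ^ (q - 1) * V j μ| ≤ B := by
    refine (Finset.abs_sum_le_sum_abs _ _).trans (Finset.sum_le_sum fun μ _ => ?_)
    rw [abs_mul, abs_mul, abs_of_pos (hr μ)]
    calc |V j μ| * (s μ ^ 2 + ε) ^ (q - 1) * |V j μ| ≤ 1 * (s μ ^ 2 + ε) ^ (q - 1) * 1 := by
          have := (hr μ).le
          have := h.abs_right_le j μ
          gcongr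
      _ = _ := by ring
  have h2 : ∀ μ ν, |dslope (fun x : ℝ => x ^ (q - 1)) (s ν ^ 2 + ε) (s μ ^ 2 + ε) *
      (U i μ * s μ * V j ν * (V j μ * (U i ν * s ν) + U i μ * s μ * V j ν))| ≤
      2 * ((s ν ^ 2 + ε) ^ (q - 1) + (s μ ^ 2 + ε) ^ (q - 1)) := by
    intro μ ν
    set Δ := dslope (fun x : ℝ => x ^ (q - 1)) (s ν ^ 2 + ε) (s μ ^ 2 + ε) with hΔ
    have hΔ0 : Δ ≤ 0 := dslope_rpow_nonpos (ht ν) (ht μ) (by linarith)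
    have hid := add_mul_dslope_rpow (ht ν) (ht μ) q
    have hpos := dslope_rpow_nonneg (ht ν) (ht μ) hq0
    rw [← hΔ] at hid
    have hsμ := h.nonneg μ
    have hsν := h.nonneg ν
    have b1 := h.abs_left_le i μ
    have b2 := h.abs_left_le i ν
    have b3 := h.abs_right_le j μ
    have b4 := h.abs_right_le j ν
    have h3 : |U i μ * s μ * V j ν * (V j μ * (U i ν * s ν) + U i μ * s μ * V j ν)| ≤
        s μ * (s ν + s μ) := by
      have h5 : |U i μ * s μ * V j ν| ≤ s μ := by
        rw [abs_mul, abs_mul, abs_of_nonneg hsμ]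
        calc |U i μ| * s μ * |V j ν| ≤ 1 * s μ * 1 := by gcongr
          _ = s μ := by ring
      have h6 : |V j μ * (U i ν * s ν)| ≤ s ν := by
        rw [abs_mul, abs_mul, abs_of_nonneg hsν]
        calc |V j μ| * (|U i ν| * s ν) ≤ 1 * (1 * s ν) := by gcongr
          _ = s ν := by ring
      rw [abs_mul]
      refine mul_le_mul h5 ((abs_add_le _ _).trans (add_le_add h6 h5)) (abs_nonneg _) hsμ
    have h7 : s μ * (s ν + s μ) ≤ 2 * (s ν ^ 2 + ε + (s μ ^ 2 + ε)) := by
      nlinarith [sq_nonneg (s μ - s ν), sq_nonneg (s μ), sq_nonneg (s ν)]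
    rw [abs_mul, abs_of_nonpos hΔ0]
    calc -Δ * |U i μ * s μ * V j ν * (V j μ * (U i ν * s ν) + U i μ * s μ * V j ν)|
        ≤ -Δ * (2 * (s ν ^ 2 + ε + (s μ ^ 2 + ε))) :=
          mul_le_mul_of_nonneg_left (h3.trans h7) (by linarith)
      _ ≤ _ := by linarith
  have h3 : |∑ μ, ∑ ν, dslope (fun x : ℝ => x ^ (q - 1)) (s ν ^ 2 + ε) (s μ ^ 2 + ε) *
      (U i μ * s μ * V j ν * (V j μ * (U i ν * s ν) + U i μ * s μ * V j ν))| ≤ 4 * m * B := by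
    refine (Finset.abs_sum_le_sum_abs _ _).trans ((Finset.sum_le_sum fun μ _ =>
      (Finset.abs_sum_le_sum_abs _ _).trans (Finset.sum_le_sum fun ν _ => h2 μ ν)).trans_eq ?_)
    simp only [← Finset.mul_sum, Finset.sum_add_distrib, Finset.sum_const, Finset.card_univ,
      Fintype.card_fin, nsmul_eq_mul]
    ring
  calc |partialGramPow q ε U s V i j| ≤ B + 4 * m * B :=
        (abs_add_le _ _).trans (add_le_add h1 h3)
    _ = (1 + 4 * m) * B := by ring
    _ ≤ (1 + 4 * m) * ((gramPow q ε X).trace / ε) := by gcongr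
    _ = _ := by ring

theorem IsSVD.hasDerivAt_smoothField (hmn : m ≤ n) (h : IsSVD X U s V) {ε : ℝ} (hε : 0 < ε)
    (q α : ℝ) (i : Fin n) (j : Fin m) :
    HasDerivAt (fun y : ℝ => smoothField q α ε (X + y • single i j (1 : ℝ)) i j)
      (-α * (partialGramPow q ε U s V i j * (gramPow q ε X).trace -
        2 * q * (X * gramPow (q - 1) ε X) i j ^ 2) / (gramPow q ε X).trace ^ 2) 0 := by
  have hF : (gramPow q ε (X + (0 : ℝ) • single i j (1 : ℝ))).trace ≠ 0 :=
    (trace_gramPow_pos hmn _ hε q j).ne'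
  have h1 := ((h.hasDerivAt_mul_gramPow hmn hε q i j).div
    (h.hasDerivAt_trace_gramPow hmn hε q i j) hF).const_mul (-α)
  have h2 : (fun y : ℝ => smoothField q α ε (X + y • single i j (1 : ℝ)) i j) = fun y : ℝ =>
      -α * (((X + y • single i j (1 : ℝ)) * gramPow (q - 1) ε (X + y • single i j (1 : ℝ))) i j /
        (gramPow q ε (X + y • single i j (1 : ℝ))).trace) := by
    funext y
    rw [smoothField, Matrix.smul_apply, smul_eq_mul]
    ring
  rw [h2]
  refine h1.congr_deriv ?_
  simp only [zero_smul, add_zero]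
  ring

end SVD

/-- The partial derivative of the `(i, j)` entry of the smoothed field in the direction of that
entry. -/
noncomputable def partialSmoothField {n m : ℕ} (q α ε : ℝ) (i : Fin n) (j : Fin m)
    (X : Matrix (Fin n) (Fin m) ℝ) : ℝ :=
  deriv (fun y : ℝ => smoothField q α ε (X + y • single i j (1 : ℝ)) i j) 0

theorem hasDerivAt_smoothField {n m : ℕ} (hmn : m ≤ n) {ε : ℝ} (hε : 0 < ε) (q α : ℝ) (i : Fin n)
    (j : Fin m) (X : Matrix (Fin n) (Fin m) ℝ) :
    HasDerivAt (fun y : ℝ => smoothField q α ε (X + y • single i j (1 : ℝ)) i j)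
      (partialSmoothField q α ε i j X) 0 := by
  obtain ⟨U, s, V, h⟩ := exists_isSVD hmn X
  exact (h.hasDerivAt_smoothField hmn hε q α i j).differentiableAt.hasDerivAt

theorem abs_smoothField_le {n m : ℕ} (hmn : m ≤ n) {ε : ℝ} (hε : 0 < ε) (q α : ℝ) (i : Fin n)
    (j : Fin m) (X : Matrix (Fin n) (Fin m) ℝ) :
    |smoothField q α ε X i j| ≤ |α| * (1 + 1 / ε) := by
  obtain ⟨U, s, V, h⟩ := exists_isSVD hmn X
  have hF := trace_gramPow_pos hmn X hε q j
  rw [smoothField, Matrix.smul_apply, smul_eq_mul, abs_mul, abs_div, abs_neg, abs_of_pos hF,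
    div_mul_eq_mul_div, div_le_iff₀ hF, mul_assoc]
  exact mul_le_mul_of_nonneg_left (h.abs_mul_gramPow_le hε q i j) (abs_nonneg _)

theorem exists_abs_partialSmoothField_le {n m : ℕ} (hmn : m ≤ n) {ε q : ℝ} (hε : 0 < ε)
    (hq0 : 0 ≤ q) (hq1 : q ≤ 1) (α : ℝ) (i : Fin n) (j : Fin m) :
    ∃ C, ∀ X, |partialSmoothField q α ε i j X| ≤ C := by
  refine ⟨|α| * ((1 + 4 * m) / ε + 2 * q * (1 + 1 / ε) ^ 2), fun X => ?_⟩
  obtain ⟨U, s, V, h⟩ := exists_isSVD hmn X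
  have hF := trace_gramPow_pos hmn X hε q j
  have h1 := h.abs_partialGramPow_le hε hq0 hq1 i j
  have h2 := h.abs_mul_gramPow_le hε q i j
  rw [partialSmoothField, (h.hasDerivAt_smoothField hmn hε q α i j).deriv]
  set F := (gramPow q ε X).trace
  set P := partialGramPow q ε U s V i j
  set W := (X * gramPow (q - 1) ε X) i j
  have h3 : W ^ 2 ≤ ((1 + 1 / ε) * F) ^ 2 := by
    have := pow_le_pow_left₀ (abs_nonneg W) h2 2
    rwa [sq_abs] at this
  rw [abs_div, abs_mul, abs_neg, abs_of_pos (pow_pos hF 2), div_le_iff₀ (pow_pos hF 2),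
    mul_assoc |α|]
  refine mul_le_mul_of_nonneg_left ?_ (abs_nonneg _)
  calc |P * F - 2 * q * W ^ 2| ≤ |P| * F + 2 * q * W ^ 2 := by
        have h4 := norm_sub_le (P * F) (2 * q * W ^ 2)
        rw [Real.norm_eq_abs, Real.norm_eq_abs, Real.norm_eq_abs] at h4
        refine h4.trans_eq ?_
        rw [abs_mul, abs_of_pos hF, abs_of_nonneg (by positivity : 0 ≤ 2 * q * W ^ 2)]
    _ ≤ (1 + 4 * m) / ε * F * F + 2 * q * ((1 + 1 / ε) * F) ^ 2 := by gcongr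
    _ = _ := by ring

/-- Stein's unbiased estimate of the excess risk of the smoothed estimator is nonpositive. -/
theorem IsAdmissible.unbiased_excess_risk_nonpos {n m : ℕ} (hmn : m ≤ n) {q α ε : ℝ}
    (hα : IsAdmissible n m (2 * q) α) (hε : 0 < ε) (X : Matrix (Fin n) (Fin m) ℝ) :
    ∑ i, ∑ j, (smoothField q α ε X i j ^ 2 + 2 * partialSmoothField q α ε i j X) ≤ 0 := by
  obtain ⟨U, s, V, h⟩ := exists_isSVD hmn X
  rcases isEmpty_or_nonempty (Fin m) with hm | ⟨⟨j₀⟩⟩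
  · simp
  have hF := trace_gramPow_pos hmn X hε q j₀
  have key := hα.unbiased_risk_le hmn hε (s := s) (fun _ => rfl)
  rw [← h.sum_partialGramPow q ε, ← h.trace_gramPow, ← h.sum_sq_mul_gramPow] at key
  set F := (gramPow q ε X).trace
  have e : ∀ i j, smoothField q α ε X i j ^ 2 + 2 * partialSmoothField q α ε i j X =
      α / F ^ 2 * ((α + 4 * q) * (X * gramPow (q - 1) ε X) i j ^ 2 -
        2 * F * partialGramPow q ε U s V i j) := by
    intro i j
    rw [partialSmoothField, (h.hasDerivAt_smoothField hmn hε q α i j).deriv, smoothField,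
      Matrix.smul_apply, smul_eq_mul]
    change (-α / F * _) ^ 2 + 2 * (-α * (_ * F - _) / F ^ 2) = _
    have := hF.ne'
    field_simp
    ring
  simp only [e, ← Finset.mul_sum, Finset.sum_sub_distrib]
  exact mul_nonpos_of_nonneg_of_nonpos (div_nonneg hα.1 (by positivity)) (by linarith)

/-! ### Stein's identity -/

/-- Stein's identity for a normal variable of variance one. -/
theorem integral_sub_mul_gaussianReal {a C C' : ℝ} {g g' : ℝ → ℝ}
    (hg : ∀ y, HasDerivAt g (g' y) y) (hC : ∀ y, |g y| ≤ C) (hC' : ∀ y, |g' y| ≤ C') :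
    ∫ y, (y - a) * g y ∂gaussianReal a 1 = ∫ y, g' y ∂gaussianReal a 1 := by
  have hgm : Measurable g :=
    (continuous_iff_continuousAt.mpr fun y => (hg y).continuousAt).measurable
  have hg'm : Measurable g' := by
    have : g' = deriv g := funext fun y => (hg y).deriv.symm
    rw [this]
    exact measurable_deriv g
  have hpdf : ∀ y, HasDerivAt (gaussianPDFReal a 1) (-(y - a) * gaussianPDFReal a 1 y) y := by
    intro y
    have h1 : HasDerivAt (fun y => -(y - a) ^ 2 / (2 * ((1 : NNReal) : ℝ))) (-(y - a)) y := by
      have h2 := (((hasDerivAt_id y).sub_const a).pow 2).neg.div_const (2 * ((1 : NNReal) : ℝ))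
      refine h2.congr_deriv ?_
      simp
      ring
    have h3 := (h1.exp).const_mul (√(2 * Real.pi * ((1 : NNReal) : ℝ)))⁻¹
    refine h3.congr_deriv ?_
    rw [gaussianPDFReal]
    ring
  have hint : Integrable (fun y => (y - a) * gaussianPDFReal a 1 y) := by
    have h1 := ((integrable_mul_exp_neg_mul_sq (b := 1 / 2) (by norm_num)).comp_sub_right
      a).const_mul (√(2 * Real.pi * ((1 : NNReal) : ℝ)))⁻¹
    refine h1.congr (ae_of_all _ fun y => ?_)
    simp only [gaussianPDFReal, NNReal.coe_one]
    ring_nf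
  have hibp := integral_mul_deriv_eq_deriv_mul_of_integrable (u := g)
    (v := gaussianPDFReal a 1) (u' := g') (v' := fun y => -(y - a) * gaussianPDFReal a 1 y)
    (fun y _ => hg y) (fun y _ => hpdf y) ?_ ?_ ?_
  · rw [integral_gaussianReal_eq_integral_smul one_ne_zero,
      integral_gaussianReal_eq_integral_smul one_ne_zero]
    have e1 : ∀ y, gaussianPDFReal a 1 y • ((y - a) * g y) =
        -(g y * (-(y - a) * gaussianPDFReal a 1 y)) := fun y => by rw [smul_eq_mul]; ring
    have e2 : ∀ y, gaussianPDFReal a 1 y • g' y = g' y * gaussianPDFReal a 1 y := fun y => by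
      rw [smul_eq_mul, mul_comm]
    simp only [e1, e2, integral_neg, hibp, neg_neg]
  · refine (hint.neg.bdd_mul hgm.aestronglyMeasurable (ae_of_all _ hC)).congr
      (ae_of_all _ fun y => ?_)
    simp only [Pi.neg_apply, Pi.mul_apply]
    ring
  · exact (integrable_gaussianPDFReal a 1).bdd_mul hg'm.aestronglyMeasurable (ae_of_all _ hC')
  · exact (integrable_gaussianPDFReal a 1).bdd_mul hgm.aestronglyMeasurable (ae_of_all _ hC)

/-- Replacing one coordinate by an independent copy preserves a product measure. -/
theorem measurePreserving_update {ι : Type*} [Fintype ι] [DecidableEq ι] {Ω : ι → Type*}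
    [∀ i, MeasurableSpace (Ω i)] (μ : ∀ i, Measure (Ω i)) [∀ i, IsProbabilityMeasure (μ i)]
    (i : ι) :
    MeasurePreserving (fun z : (∀ i, Ω i) × Ω i => Function.update z.1 i z.2)
      ((Measure.pi μ).prod (μ i)) (Measure.pi μ) := by
  have hm : Measurable (fun z : (∀ i, Ω i) × Ω i => Function.update z.1 i z.2) := by
    refine measurable_pi_lambda _ fun k => ?_
    by_cases hk : k = i
    · subst hk
      simpa using measurable_snd
    · simp only [Function.update_of_ne hk]
      exact (measurable_pi_apply k).comp measurable_fst
  refine ⟨hm, (Measure.pi_eq fun S hS => ?_).symm⟩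
  rw [Measure.map_apply hm (MeasurableSet.univ_pi hS)]
  have e : (fun z : (∀ i, Ω i) × Ω i => Function.update z.1 i z.2) ⁻¹' Set.univ.pi S =
      Set.univ.pi (Function.update S i Set.univ) ×ˢ S i := by
    ext z
    simp only [Set.mem_preimage, Set.mem_pi, Set.mem_univ, true_implies, Set.mem_prod]
    constructor
    · intro h
      refine ⟨fun k => ?_, by simpa using h i⟩
      by_cases hk : k = i
      · subst hk; simp
      · simpa [hk] using h k
    · rintro ⟨h1, h2⟩ k
      by_cases hk : k = i
      · subst hk; simpa using h2
      · simpa [hk] using h1 k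
  rw [e, Measure.prod_prod, Measure.pi_pi, ← Finset.mul_prod_erase _ _ (Finset.mem_univ i),
    ← Finset.mul_prod_erase Finset.univ (fun k => μ k (S k)) (Finset.mem_univ i)]
  simp only [Function.update_self, measure_univ, one_mul]
  rw [mul_comm]
  congr 1
  refine Finset.prod_congr rfl fun k hk => ?_
  rw [Function.update_of_ne (Finset.ne_of_mem_erase hk)]

section Matrix

variable {n m : ℕ}

instance instBorelSpaceMatrix : BorelSpace (Matrix (Fin n) (Fin m) ℝ) :=
  inferInstanceAs (BorelSpace (Fin n → Fin m → ℝ))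

theorem measurePreserving_entry (M : Matrix (Fin n) (Fin m) ℝ) (i : Fin n) (j : Fin m) :
    MeasurePreserving (fun X : Matrix (Fin n) (Fin m) ℝ => X i j) (normalMatrix M)
      (gaussianReal (M i j) 1) := by
  have hrow : ∀ i, IsProbabilityMeasure (Measure.pi fun j => gaussianReal (M i j) 1) :=
    fun i => inferInstance
  exact (measurePreserving_eval (fun j => gaussianReal (M i j) 1) j).comp
    (measurePreserving_eval (fun i => Measure.pi (fun j => gaussianReal (M i j) 1)) i)

/-- Replacing the `(i, j)` entry of a normal matrix by an independent copy preserves its law. -/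
theorem measurePreserving_update_entry (M : Matrix (Fin n) (Fin m) ℝ) (i : Fin n) (j : Fin m) :
    MeasurePreserving (fun z : Matrix (Fin n) (Fin m) ℝ × ((Fin m → ℝ) × ℝ) =>
        z.1.updateRow i (Function.update z.2.1 j z.2.2))
      ((normalMatrix M).prod
        ((Measure.pi fun j => gaussianReal (M i j) 1).prod (gaussianReal (M i j) 1)))
      (normalMatrix M) := by
  have hrow : ∀ i, IsProbabilityMeasure (Measure.pi fun j => gaussianReal (M i j) 1) :=
    fun i => inferInstance
  exact (measurePreserving_update (fun i => Measure.pi (fun j => gaussianReal (M i j) 1)) i).comp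
    ((MeasurePreserving.id (normalMatrix M)).prod
      (measurePreserving_update (fun j => gaussianReal (M i j) 1) j))

theorem measurable_of_hasDerivAt {g D : Matrix (Fin n) (Fin m) ℝ → ℝ}
    {E : Matrix (Fin n) (Fin m) ℝ} (hg : Continuous g)
    (hD : ∀ X, HasDerivAt (fun y : ℝ => g (X + y • E)) (D X) 0) : Measurable D := by
  have hlim : Tendsto (fun k : ℕ => 1 / ((k : ℝ) + 1)) atTop (𝓝[≠] 0) := by
    refine tendsto_nhdsWithin_iff.mpr ⟨tendsto_one_div_add_atTop_nhds_zero_nat, ?_⟩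
    exact Eventually.of_forall fun k => by simp; positivity
  refine measurable_of_tendsto_metrizable (f := fun (k : ℕ) X =>
    slope (fun y : ℝ => g (X + y • E)) 0 (1 / ((k : ℝ) + 1))) (fun k => ?_) ?_
  · simp only [slope_def_field]
    refine Continuous.measurable ?_
    have h1 : ∀ y : ℝ, Continuous fun X : Matrix (Fin n) (Fin m) ℝ => g (X + y • E) := fun y =>
      hg.comp (continuous_id.add continuous_const)
    exact ((h1 _).sub (h1 _)).div_const _
  · rw [tendsto_pi_nhds]
    intro X
    exact (hasDerivAt_iff_tendsto_slope.mp (hD X)).comp hlim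

/-- Stein's identity for an entry of a normal matrix. -/
theorem integral_sub_mul_normalMatrix (M : Matrix (Fin n) (Fin m) ℝ) (i : Fin n) (j : Fin m)
    {g D : Matrix (Fin n) (Fin m) ℝ → ℝ} {C C' : ℝ} (hg : Continuous g)
    (hD : ∀ X, HasDerivAt (fun y : ℝ => g (X + y • single i j (1 : ℝ))) (D X) 0)
    (hC : ∀ X, |g X| ≤ C) (hC' : ∀ X, |D X| ≤ C') :
    Integrable D (normalMatrix M) ∧
    Integrable (fun X => (X i j - M i j) * g X) (normalMatrix M) ∧
      ∫ X, (X i j - M i j) * g X ∂(normalMatrix M) = ∫ X, D X ∂(normalMatrix M) := by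
  have hDm := measurable_of_hasDerivAt hg hD
  have hDi : Integrable D (normalMatrix M) :=
    Integrable.of_bound hDm.aestronglyMeasurable C' (ae_of_all _ hC')
  have hXi : Integrable (fun X : Matrix (Fin n) (Fin m) ℝ => X i j - M i j) (normalMatrix M) := by
    have h1 : Integrable (fun y : ℝ => y - M i j) (gaussianReal (M i j) 1) :=
      ((memLp_id_gaussianReal 1).integrable le_rfl).sub (integrable_const _)
    exact (measurePreserving_entry M i j).integrable_comp_of_integrable h1
  have hgi : Integrable (fun X => (X i j - M i j) * g X) (normalMatrix M) :=
    hXi.mul_bdd hg.measurable.aestronglyMeasurable (ae_of_all _ hC)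
  refine ⟨hDi, hgi, ?_⟩
  have hmp := measurePreserving_update_entry M i j
  have hshift : ∀ (X : Matrix (Fin n) (Fin m) ℝ) (r : Fin m → ℝ) (y : ℝ),
      X.updateRow i (Function.update r j y) =
        X.updateRow i (Function.update r j 0) + y • single i j (1 : ℝ) := by
    intro X r y
    ext k l
    rw [Matrix.add_apply, Matrix.smul_apply]
    by_cases hk : k = i
    · subst hk
      by_cases hl : l = j
      · subst hl; simp
      · simp [hl, Ne.symm hl]
    · simp [hk, Ne.symm hk]
  have hint : ∀ {φ : Matrix (Fin n) (Fin m) ℝ → ℝ}, Integrable φ (normalMatrix M) →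
      ∫ X, φ X ∂(normalMatrix M) = ∫ z, ∫ y, φ (z.1.updateRow i (Function.update z.2 j y))
        ∂(gaussianReal (M i j) 1)
        ∂((normalMatrix M).prod (Measure.pi fun j => gaussianReal (M i j) 1)) := by
    intro φ hφ
    have hmp' := hmp.comp (measurePreserving_prodAssoc (normalMatrix M)
      (Measure.pi fun j => gaussianReal (M i j) 1) (gaussianReal (M i j) 1))
    have h1 := integral_map (f := φ) hmp'.aemeasurable
      (by rw [hmp'.map_eq]; exact hφ.aestronglyMeasurable)
    rw [hmp'.map_eq] at h1
    rw [h1]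
    exact integral_prod _ (hmp'.integrable_comp_of_integrable hφ)
  rw [hint hgi, hint hDi]
  refine integral_congr_ae (ae_of_all _ fun z => ?_)
  set Y := z.1.updateRow i (Function.update z.2 j 0)
  have hder : ∀ y, HasDerivAt (fun y : ℝ => g (Y + y • single i j (1 : ℝ)))
      (D (Y + y • single i j (1 : ℝ))) y := by
    intro y
    have h1 := hD (Y + y • single i j (1 : ℝ))
    rw [← sub_self y] at h1
    refine (h1.comp_sub_const y y).congr_of_eventuallyEq (Eventually.of_forall fun w => ?_)
    simp only [add_assoc, ← add_smul, add_sub_cancel]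
  have hst := integral_sub_mul_gaussianReal (a := M i j) hder (fun y => hC _) (fun y => hC' _)
  have e : ∀ y : ℝ, z.1.updateRow i (Function.update z.2 j y) = Y + y • single i j (1 : ℝ) :=
    hshift z.1 z.2
  simp only [e]
  have hent : ∀ y : ℝ, (Y + y • single i j (1 : ℝ)) i j = y := by
    intro y
    simp [Y]
  simp only [← hst]
  refine integral_congr_ae (ae_of_all _ fun y => ?_)
  change ((Y + y • single i j (1 : ℝ)) i j - M i j) * _ = _
  rw [hent]

end Matrix

/-! ### The risk of the shrinkage estimator -/

section Risk

variable {n m : ℕ}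

theorem integral_sub_sq_gaussianReal (a : ℝ) : ∫ y, (y - a) ^ 2 ∂gaussianReal a 1 = 1 := by
  have h1 := variance_eq_integral (μ := gaussianReal a 1) (X := id) measurable_id.aemeasurable
  rw [variance_id_gaussianReal] at h1
  simp only [id, integral_id_gaussianReal] at h1
  simpa using h1.symm

theorem integrable_sub_sq_gaussianReal (a : ℝ) :
    Integrable (fun y => (y - a) ^ 2) (gaussianReal a 1) :=
  ((memLp_id_gaussianReal 2).sub (memLp_const a)).integrable_sq

theorem integrable_sub_sq_normalMatrix (M : Matrix (Fin n) (Fin m) ℝ) (i : Fin n) (j : Fin m) :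
    Integrable (fun X => (X i j - M i j) ^ 2) (normalMatrix M) :=
  (measurePreserving_entry M i j).integrable_comp_of_integrable (integrable_sub_sq_gaussianReal _)

theorem integral_sub_sq_normalMatrix (M : Matrix (Fin n) (Fin m) ℝ) (i : Fin n) (j : Fin m) :
    ∫ X, (X i j - M i j) ^ 2 ∂(normalMatrix M) = 1 := by
  have hmp := measurePreserving_entry M i j
  rw [← integral_sub_sq_gaussianReal (M i j), ← hmp.map_eq,
    integral_map hmp.aemeasurable (by fun_prop)]

/-- The risk of the smoothed shrinkage estimator is at most the constant risk `n m` of `X`. -/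
theorem IsAdmissible.frobeniusRisk_add_smoothField_le (hmn : m ≤ n) {q α ε : ℝ}
    (hα : IsAdmissible n m (2 * q) α) (hε : 0 < ε) (M : Matrix (Fin n) (Fin m) ℝ) :
    frobeniusRisk (fun X => X + smoothField q α ε X) M ≤ ENNReal.ofReal (n * m) := by
  have hq0 : 0 ≤ q := by linarith [hα.pos]
  have hq1 : q ≤ 1 := by linarith [hα.le_two]
  have hgc : ∀ i j, Continuous fun X : Matrix (Fin n) (Fin m) ℝ => smoothField q α ε X i j :=
    fun i j => (continuous_smoothField hmn hε q α).matrix_elem i j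
  have hst : ∀ i j, Integrable (partialSmoothField q α ε i j) (normalMatrix M) ∧
      Integrable (fun X => (X i j - M i j) * smoothField q α ε X i j) (normalMatrix M) ∧
      ∫ X, (X i j - M i j) * smoothField q α ε X i j ∂(normalMatrix M) =
        ∫ X, partialSmoothField q α ε i j X ∂(normalMatrix M) := by
    intro i j
    obtain ⟨C, hC⟩ := exists_abs_partialSmoothField_le hmn hε hq0 hq1 α i j
    exact integral_sub_mul_normalMatrix M i j (hgc i j) (hasDerivAt_smoothField hmn hε q α i j)
      (abs_smoothField_le hmn hε q α i j) hC
  have hsq : ∀ i j, Integrable (fun X => smoothField q α ε X i j ^ 2) (normalMatrix M) := by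
    intro i j
    refine Integrable.of_bound ((hgc i j).pow 2).measurable.aestronglyMeasurable
      ((|α| * (1 + 1 / ε)) ^ 2) (ae_of_all _ fun X => ?_)
    rw [Real.norm_eq_abs, abs_pow]
    exact pow_le_pow_left₀ (abs_nonneg _) (abs_smoothField_le hmn hε q α i j X) 2
  have hexp : ∀ (X : Matrix (Fin n) (Fin m) ℝ) i j, ((X + smoothField q α ε X) i j - M i j) ^ 2 =
      (X i j - M i j) ^ 2 + (2 * ((X i j - M i j) * smoothField q α ε X i j) +
        smoothField q α ε X i j ^ 2) := by
    intro X i j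
    rw [Matrix.add_apply]
    ring
  have hint : ∀ i j, Integrable (fun X => ((X + smoothField q α ε X) i j - M i j) ^ 2)
      (normalMatrix M) := by
    intro i j
    simp only [hexp]
    exact (integrable_sub_sq_normalMatrix M i j).add (((hst i j).2.1.const_mul 2).add (hsq i j))
  have hval : ∀ i j, ∫ X, ((X + smoothField q α ε X) i j - M i j) ^ 2 ∂(normalMatrix M) =
      1 + ∫ X, (smoothField q α ε X i j ^ 2 + 2 * partialSmoothField q α ε i j X)
        ∂(normalMatrix M) := by
    intro i j
    have h1 := integral_add (integrable_sub_sq_normalMatrix M i j)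
      (((hst i j).2.1.const_mul 2).add (hsq i j))
    have h2 := integral_add ((hst i j).2.1.const_mul 2) (hsq i j)
    have h3 := integral_add (hsq i j) ((hst i j).1.const_mul 2)
    rw [integral_const_mul] at h2 h3
    rw [(hst i j).2.2] at h2
    simp only [Pi.add_apply] at h1
    simp only [hexp]
    rw [h1, h2, h3, integral_sub_sq_normalMatrix, add_comm (2 * _)]
  have hrisk : frobeniusRisk (fun X => X + smoothField q α ε X) M = ENNReal.ofReal
      (∫ X, ∑ i, ∑ j, ((X + smoothField q α ε X) i j - M i j) ^ 2 ∂(normalMatrix M)) :=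
    (ofReal_integral_eq_lintegral_ofReal
      (integrable_finsetSum _ fun i _ => integrable_finsetSum _ fun j _ => hint i j)
      (ae_of_all _ fun X => Finset.sum_nonneg fun i _ => Finset.sum_nonneg fun j _ =>
        sq_nonneg _)).symm
  rw [hrisk]
  refine ENNReal.ofReal_le_ofReal ?_
  have hint2 : ∀ i j, Integrable (fun X => smoothField q α ε X i j ^ 2 +
      2 * partialSmoothField q α ε i j X) (normalMatrix M) := fun i j =>
    (hsq i j).add ((hst i j).1.const_mul 2)
  calc ∫ X, ∑ i, ∑ j, ((X + smoothField q α ε X) i j - M i j) ^ 2 ∂(normalMatrix M)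
      = ∑ i, ∑ j, ∫ X, ((X + smoothField q α ε X) i j - M i j) ^ 2 ∂(normalMatrix M) := by
        rw [integral_finsetSum _ fun i _ => integrable_finsetSum _ fun j _ => hint i j]
        exact Finset.sum_congr rfl fun i _ => integral_finsetSum _ fun j _ => hint i j
    _ = n * m + ∫ X, ∑ i, ∑ j, (smoothField q α ε X i j ^ 2 +
          2 * partialSmoothField q α ε i j X) ∂(normalMatrix M) := by
        rw [integral_finsetSum _ fun i _ => integrable_finsetSum _ fun j _ => hint2 i j]
        rw [Finset.sum_congr rfl fun i _ => integral_finsetSum _ fun j _ => hint2 i j]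
        simp only [hval, Finset.sum_add_distrib, Finset.sum_const, Finset.card_univ,
          Fintype.card_fin, nsmul_eq_mul, mul_one]
    _ ≤ n * m + 0 := by
        gcongr
        exact integral_nonpos fun X => hα.unbiased_excess_risk_nonpos hmn hε X
    _ = n * m := add_zero _

/-- As the smoothing parameter tends to zero, the smoothed estimator tends to the shrinkage
estimator at every matrix, singular ones included. -/
theorem tendsto_add_smoothField (hmn : m ≤ n) {p : ℝ} (hp : 0 < p) (α : ℝ) {ε : ℕ → ℝ}
    (hε0 : Tendsto ε atTop (𝓝 0)) (X : Matrix (Fin n) (Fin m) ℝ) (i : Fin n) (j : Fin m) :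
    Tendsto (fun k => (X + smoothField (p / 2) α (ε k) X) i j) atTop
      (𝓝 (normShrinkageEstimator p α X i j)) := by
  obtain ⟨U, s, V, h⟩ := exists_isSVD hmn X
  have hX : X i j = ∑ μ, U i μ * s μ * V j μ := by
    conv_lhs => rw [h.eq]
    exact conj_diagonal_apply _ _ _ _ _
  have hsq : ∀ μ (r : ℝ), (s μ ^ 2 + 0) ^ (r / 2) = s μ ^ r := by
    intro μ r
    rw [add_zero, ← Real.rpow_natCast, ← Real.rpow_mul (h.nonneg μ)]
    congr 1
    push_cast
    ring
  have hlim : ∀ μ (r : ℝ), s μ ^ 2 ≠ 0 ∨ 0 < r / 2 →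
      Tendsto (fun k => (s μ ^ 2 + ε k) ^ (r / 2)) atTop (𝓝 (s μ ^ r)) := by
    intro μ r hr
    rw [← hsq]
    refine Tendsto.rpow_const (tendsto_const_nhds.add hε0) ?_
    rcases hr with hr | hr
    · exact Or.inl (by rwa [add_zero])
    · exact Or.inr hr.le
  rw [normShrinkageEstimator_eq p α h, conj_diagonal_apply]
  simp only [Matrix.add_apply, h.smoothField_eq, conj_diagonal_apply, hX,
    ← Finset.sum_add_distrib]
  refine tendsto_finsetSum _ fun μ _ => ?_
  simp only [← add_mul, ← mul_add]
  refine Tendsto.mul_const _ (Tendsto.const_mul _ ?_)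
  rw [normShrinkage]
  rcases (h.nonneg μ).eq_or_lt with h0 | hpos
  · simp [← h0]
  · have hS : ∑ ν, s ν ^ p ≠ 0 :=
      (Finset.sum_pos' (fun ν _ => Real.rpow_nonneg (h.nonneg ν) p)
        ⟨μ, Finset.mem_univ μ, Real.rpow_pos_of_pos hpos p⟩).ne'
    have h1 : Tendsto (fun k => ∑ ν, (s ν ^ 2 + ε k) ^ (p / 2)) atTop (𝓝 (∑ ν, s ν ^ p)) :=
      tendsto_finsetSum _ fun ν _ => hlim ν p (Or.inr (by linarith))
    have h2 := hlim μ (p - 2) (Or.inl (pow_pos hpos 2).ne')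
    have e : (1 - α * (s μ ^ (p - 2) / ∑ ν, s ν ^ p)) * s μ =
        s μ + -α / (∑ ν, s ν ^ p) * (s μ * s μ ^ (p - 2)) := by ring
    rw [e]
    have e2 : p / 2 - 1 = (p - 2) / 2 := by ring
    rw [e2]
    exact (((tendsto_const_nhds.div h1 hS).mul (h2.const_mul _))).const_add _

theorem IsAdmissible.measurable_normShrinkageEstimator (hmn : m ≤ n) {p α : ℝ}
    (hα : IsAdmissible n m p α) :
    Measurable (normShrinkageEstimator p α : Matrix (Fin n) (Fin m) ℝ → _) := by
  refine measurable_pi_lambda _ fun i => measurable_pi_lambda _ fun j => ?_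
  refine measurable_of_tendsto_metrizable (f := fun (k : ℕ) (X : Matrix (Fin n) (Fin m) ℝ) =>
    (X + smoothField (p / 2) α (1 / ((k : ℝ) + 1)) X) i j) (fun k => ?_) ?_
  · exact ((continuous_id.add (continuous_smoothField hmn (by positivity) (p / 2) α)).matrix_elem
      i j).measurable
  · exact tendsto_pi_nhds.mpr fun X =>
      tendsto_add_smoothField hmn hα.pos α tendsto_one_div_add_atTop_nhds_zero_nat X i j

/-- Fatou's lemma carries the bound on the risk over from the smoothed estimators. -/
theorem IsAdmissible.frobeniusRisk_normShrinkageEstimator_le (hmn : m ≤ n) {p α : ℝ}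
    (hα : IsAdmissible n m p α) (M : Matrix (Fin n) (Fin m) ℝ) :
    frobeniusRisk (normShrinkageEstimator p α) M ≤ ENNReal.ofReal (n * m) := by
  set ε : ℕ → ℝ := fun k => 1 / ((k : ℝ) + 1)
  have hε : ∀ k, 0 < ε k := fun k => by positivity
  have hα' : IsAdmissible n m (2 * (p / 2)) α := by rwa [mul_div_cancel₀ p two_ne_zero]
  let f : ℕ → Matrix (Fin n) (Fin m) ℝ → ℝ≥0∞ := fun k X =>
    frobeniusLoss M (X + smoothField (p / 2) α (ε k) X)
  have hlim : ∀ X, Tendsto (fun k => f k X) atTop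
      (𝓝 (frobeniusLoss M (normShrinkageEstimator p α X))) := by
    intro X
    refine ENNReal.tendsto_ofReal (tendsto_finsetSum _ fun i _ => tendsto_finsetSum _ fun j _ => ?_)
    exact ((tendsto_add_smoothField hmn hα.pos α tendsto_one_div_add_atTop_nhds_zero_nat X i
      j).sub_const _).pow 2
  have hmeas : ∀ k, Measurable (f k) := by
    intro k
    refine ENNReal.measurable_ofReal.comp (Continuous.measurable ?_)
    refine continuous_finsetSum _ fun i _ => continuous_finsetSum _ fun j _ => ?_
    exact (((continuous_id.add (continuous_smoothField hmn (hε k) (p / 2) α)).matrix_elem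
      i j).sub continuous_const).pow 2
  calc frobeniusRisk (normShrinkageEstimator p α) M
      = ∫⁻ X, liminf (fun k => f k X) atTop ∂(normalModel n m M) :=
        lintegral_congr fun X => (hlim X).liminf_eq.symm
    _ ≤ liminf (fun k => ∫⁻ X, f k X ∂(normalModel n m M)) atTop := lintegral_liminf_le hmeas
    _ ≤ liminf (fun _ : ℕ => ENNReal.ofReal (n * m)) atTop :=
        liminf_le_liminf (Eventually.of_forall fun k =>
          hα'.frobeniusRisk_add_smoothField_le hmn (hε k) M)
    _ = _ := liminf_const _

end Risk

/-! ### The minimax risk -/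

section Minimax

variable {n m : ℕ}

instance instSecondCountableTopologyMatrix :
    SecondCountableTopology (Matrix (Fin n) (Fin m) ℝ) :=
  inferInstanceAs (SecondCountableTopology (Fin n → Fin m → ℝ))

theorem measurable_frobeniusLoss : Measurable fun z : Matrix (Fin n) (Fin m) ℝ ×
    Matrix (Fin n) (Fin m) ℝ => frobeniusLoss z.1 z.2 := by
  refine ENNReal.measurable_ofReal.comp (Finset.measurable_sum _ fun i _ =>
    Finset.measurable_sum _ fun j _ => ?_)
  have he : Measurable fun A : Matrix (Fin n) (Fin m) ℝ => A i j :=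
    (continuous_id.matrix_elem i j).measurable
  exact ((he.comp measurable_snd).sub (he.comp measurable_fst)).pow_const 2

theorem measurable_frobeniusLoss_right (M : Matrix (Fin n) (Fin m) ℝ) :
    Measurable (frobeniusLoss M) := by
  refine ENNReal.measurable_ofReal.comp (Continuous.measurable ?_)
  exact continuous_finsetSum _ fun i _ => continuous_finsetSum _ fun j _ =>
    ((continuous_id.matrix_elem i j).sub continuous_const).pow 2

/-- A finite product of Gaussian measures is Gaussian. -/
theorem isGaussian_pi {ι E : Type} [Fintype ι] [NormedAddCommGroup E] [NormedSpace ℝ E]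
    [MeasurableSpace E] [BorelSpace E] [CompleteSpace E] [SecondCountableTopology E]
    (μ : ι → Measure E) [∀ i, IsGaussian (μ i)] : IsGaussian (Measure.pi μ) := by
  have h1 : iIndepFun (fun i (ω : ι → E) => ω i) (Measure.pi μ) :=
    iIndepFun_pi (X := fun _ => id) fun i => measurable_id.aemeasurable
  have h2 : HasGaussianLaw (fun ω : ι → E => (fun i => ω i)) (Measure.pi μ) :=
    h1.hasGaussianLaw fun i => ⟨by
      rw [(measurePreserving_eval μ i).map_eq]; infer_instance⟩
  have h3 := h2.isGaussian_map
  rwa [show (fun ω : ι → E => (fun i => ω i)) = id from rfl, Measure.map_id] at h3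

theorem map_rotation_pi_pi_gaussianReal (n m : ℕ) (θ : ℝ) :
    ((Measure.pi fun _ : Fin n => Measure.pi fun _ : Fin m => gaussianReal 0 1).prod
        (Measure.pi fun _ : Fin n => Measure.pi fun _ : Fin m => gaussianReal 0 1)).map
        (ContinuousLinearMap.rotation θ) =
      (Measure.pi fun _ : Fin n => Measure.pi fun _ : Fin m => gaussianReal 0 1).prod
        (Measure.pi fun _ : Fin n => Measure.pi fun _ : Fin m => gaussianReal 0 1) := by
  have h1 : IsGaussian (Measure.pi fun _ : Fin m => gaussianReal 0 1) := isGaussian_pi _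
  have h2 : IsGaussian (Measure.pi fun _ : Fin n => Measure.pi fun _ : Fin m =>
    gaussianReal 0 1) := isGaussian_pi _
  refine IsGaussian.map_rotation_eq_self ?_ θ
  have hint : Integrable (fun x : Fin n → Fin m → ℝ => x)
      (Measure.pi fun _ : Fin n => Measure.pi fun _ : Fin m => gaussianReal 0 1) :=
    IsGaussian.integrable_id
  have hint1 : Integrable (fun x : Fin m → ℝ => x)
      (Measure.pi fun _ : Fin m => gaussianReal 0 1) := IsGaussian.integrable_id
  have hrow : ∫ x, x ∂(Measure.pi fun _ : Fin m => gaussianReal 0 1) = 0 := by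
    funext j
    rw [eval_integral fun j => Integrable.eval hint1 j]
    have h3 := integral_map (f := fun y : ℝ => y)
      (measurePreserving_eval (fun _ : Fin m => gaussianReal 0 1) j).aemeasurable
      measurable_id.aestronglyMeasurable
    rw [(measurePreserving_eval (fun _ : Fin m => gaussianReal 0 1) j).map_eq] at h3
    exact h3.symm.trans integral_id_gaussianReal
  change ∫ x, x ∂_ = _
  funext i
  rw [eval_integral fun i => Integrable.eval hint i]
  have h3 := integral_map (f := fun y : Fin m → ℝ => y)
    (measurePreserving_eval (fun _ : Fin n => Measure.pi fun _ : Fin m => gaussianReal 0 1)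
      i).aemeasurable measurable_id.aestronglyMeasurable
  rw [(measurePreserving_eval (fun _ : Fin n => Measure.pi fun _ : Fin m => gaussianReal 0 1)
    i).map_eq] at h3
  exact h3.symm.trans hrow

/-- The product of two copies of a standard normal matrix is invariant under rotations. -/
theorem lintegral_rotation_normalMatrix (θ : ℝ)
    {Φ : Matrix (Fin n) (Fin m) ℝ × Matrix (Fin n) (Fin m) ℝ → ℝ≥0∞} (hΦ : Measurable Φ) :
    ∫⁻ z, Φ (Real.cos θ • z.1 + Real.sin θ • z.2, -Real.sin θ • z.1 + Real.cos θ • z.2)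
        ∂((normalMatrix 0).prod (normalMatrix 0)) =
      ∫⁻ z, Φ z ∂((normalMatrix 0).prod (normalMatrix 0)) := by
  have hrot : ((normalMatrix (0 : Matrix (Fin n) (Fin m) ℝ)).prod (normalMatrix 0)).map
      (fun z => (Real.cos θ • z.1 + Real.sin θ • z.2, -Real.sin θ • z.1 + Real.cos θ • z.2)) =
      (normalMatrix 0).prod (normalMatrix 0) := map_rotation_pi_pi_gaussianReal n m θ
  have hm : Measurable fun z : Matrix (Fin n) (Fin m) ℝ × Matrix (Fin n) (Fin m) ℝ =>
      (Real.cos θ • z.1 + Real.sin θ • z.2, -Real.sin θ • z.1 + Real.cos θ • z.2) :=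
    (ContinuousLinearMap.rotation (E := Fin n → Fin m → ℝ) θ).continuous.measurable
  have h1 := lintegral_map (μ := (normalMatrix (0 : Matrix (Fin n) (Fin m) ℝ)).prod
    (normalMatrix 0)) hΦ hm
  rw [hrot] at h1
  exact h1.symm

theorem le_lintegral_normalMatrix_quadratic (v : Matrix (Fin n) (Fin m) ℝ) (c : ℝ) :
    ENNReal.ofReal (c ^ 2 * (n * m)) ≤
      ∫⁻ b, ENNReal.ofReal (∑ i, ∑ j, (v i j + c * b i j) ^ 2)
        ∂(normalMatrix (0 : Matrix (Fin n) (Fin m) ℝ)) := by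
  have hsq : Integrable (fun y : ℝ => y ^ 2) (gaussianReal 0 1) := by
    simpa using integrable_sub_sq_gaussianReal 0
  have hid : Integrable (fun y : ℝ => y) (gaussianReal 0 1) :=
    (memLp_id_gaussianReal 1).integrable le_rfl
  have e : ∀ w y : ℝ, (w + c * y) ^ 2 = w ^ 2 + (2 * w * c * y + c ^ 2 * y ^ 2) :=
    fun w y => by ring
  have h1 : ∀ w : ℝ, Integrable (fun y : ℝ => (w + c * y) ^ 2) (gaussianReal 0 1) := by
    intro w
    simp only [e]
    exact (integrable_const _).add ((hid.const_mul _).add (hsq.const_mul _))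
  have h2 : ∀ w : ℝ, c ^ 2 ≤ ∫ y, (w + c * y) ^ 2 ∂gaussianReal 0 1 := by
    intro w
    have h3 : ∫ y : ℝ, y ^ 2 ∂gaussianReal 0 1 = 1 := by
      simpa using integral_sub_sq_gaussianReal 0
    have h4 := integral_add (hid.const_mul (2 * w * c)) (hsq.const_mul (c ^ 2))
    have h5 := integral_add (integrable_const (w ^ 2))
      ((hid.const_mul (2 * w * c)).add (hsq.const_mul (c ^ 2)))
    simp only [Pi.add_apply] at h5
    simp only [e]
    rw [h5, h4, integral_const_mul, integral_const_mul, h3, integral_id_gaussianReal]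
    simp [sq_nonneg]
  have hmp := fun i j => measurePreserving_entry (0 : Matrix (Fin n) (Fin m) ℝ) i j
  have hint : ∀ i j, Integrable (fun b => (v i j + c * b i j) ^ 2)
      (normalMatrix (0 : Matrix (Fin n) (Fin m) ℝ)) := fun i j =>
    (hmp i j).integrable_comp_of_integrable (h1 (v i j))
  have hval : ∀ i j, c ^ 2 ≤ ∫ b, (v i j + c * b i j) ^ 2
      ∂(normalMatrix (0 : Matrix (Fin n) (Fin m) ℝ)) := by
    intro i j
    have h3 := integral_map (f := fun y : ℝ => (v i j + c * y) ^ 2) (hmp i j).aemeasurable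
      (by fun_prop)
    rw [(hmp i j).map_eq] at h3
    exact (h2 (v i j)).trans_eq h3
  rw [← ofReal_integral_eq_lintegral_ofReal
    (integrable_finsetSum _ fun i _ => integrable_finsetSum _ fun j _ => hint i j)
    (ae_of_all _ fun X => Finset.sum_nonneg fun i _ => Finset.sum_nonneg fun j _ => sq_nonneg _)]
  refine ENNReal.ofReal_le_ofReal ?_
  rw [integral_finsetSum _ fun i _ => integrable_finsetSum _ fun j _ => hint i j,
    Finset.sum_congr rfl fun i _ => integral_finsetSum _ fun j _ => hint i j]
  calc c ^ 2 * (n * m) = ∑ _ : Fin n, ∑ _ : Fin m, c ^ 2 := by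
        simp only [Finset.sum_const, Finset.card_univ, Fintype.card_fin, nsmul_eq_mul]; ring
    _ ≤ _ := Finset.sum_le_sum fun i _ => Finset.sum_le_sum fun j _ => hval i j

/-- If the parameter is `A - c • b` with `b` standard normal, a randomized estimate that is
independent of `b` has risk at least `c² n m`. -/
theorem le_lintegral_lintegral_frobeniusLoss (ν : Measure (Matrix (Fin n) (Fin m) ℝ))
    [IsProbabilityMeasure ν] (A : Matrix (Fin n) (Fin m) ℝ) (c : ℝ) :
    ENNReal.ofReal (c ^ 2 * (n * m)) ≤
      ∫⁻ b, ∫⁻ D, frobeniusLoss (A - c • b) D ∂ν ∂(normalMatrix 0) := by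
  have h0 : Measurable fun b : Matrix (Fin n) (Fin m) ℝ => A - c • b :=
    (continuous_const.sub (continuous_id.const_smul c)).measurable
  have h1 := measurable_frobeniusLoss.comp ((h0.comp measurable_fst).prodMk
    (measurable_snd (β := Matrix (Fin n) (Fin m) ℝ)))
  rw [lintegral_lintegral_swap (f := fun b D => frobeniusLoss (A - c • b) D) h1.aemeasurable]
  calc ENNReal.ofReal (c ^ 2 * (n * m))
      = ∫⁻ _, ENNReal.ofReal (c ^ 2 * (n * m)) ∂ν := by simp
    _ ≤ ∫⁻ D, ∫⁻ b, frobeniusLoss (A - c • b) D ∂(normalMatrix 0) ∂ν := by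
        refine lintegral_mono fun D => ?_
        refine (le_lintegral_normalMatrix_quadratic (D - A) c).trans_eq ?_
        refine lintegral_congr fun b => ?_
        rw [frobeniusLoss]
        congr 1
        refine Finset.sum_congr rfl fun i _ => Finset.sum_congr rfl fun j _ => ?_
        simp only [Matrix.sub_apply, Matrix.smul_apply, smul_eq_mul]
        ring

/-- The Bayes risk under the prior with independent `N(0, cot² θ)` entries bounds the minimax risk
from below. A rotation by the angle `θ` turns the pair of the parameter `cot θ • Z₁` and the
observation `cot θ • Z₁ + Z₂` into one where the observation is independent of the error of its
optimal linear predictor. -/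
theorem cos_sq_mul_le_minimaxRisk {θ : ℝ} (hθ : Real.sin θ ≠ 0) :
    ENNReal.ofReal (Real.cos θ ^ 2 * (n * m)) ≤
      minimaxRisk frobeniusLoss (normalModel n m) := by
  refine le_iInf₂ fun κ hκ => ?_
  set c := Real.cos θ
  set s := Real.sin θ
  set μ := normalMatrix (0 : Matrix (Fin n) (Fin m) ℝ)
  let Ψ : Matrix (Fin n) (Fin m) ℝ × Matrix (Fin n) (Fin m) ℝ → ℝ≥0∞ := fun z =>
    ∫⁻ D, frobeniusLoss z.1 D ∂(κ z.2)
  have hΨ : Measurable Ψ := by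
    have h0 : Measurable fun w : (Matrix (Fin n) (Fin m) ℝ × Matrix (Fin n) (Fin m) ℝ) ×
        Matrix (Fin n) (Fin m) ℝ => (w.1.1, w.2) :=
      (measurable_fst.comp measurable_fst).prodMk measurable_snd
    have h1 := measurable_frobeniusLoss.comp h0
    exact Measurable.lintegral_kernel_prod_right' (κ := κ.comap Prod.snd measurable_snd) h1
  let Φ : Matrix (Fin n) (Fin m) ℝ × Matrix (Fin n) (Fin m) ℝ → ℝ≥0∞ := fun z =>
    Ψ ((c ^ 2 / s) • z.1 - c • z.2, (1 / s) • z.1)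
  have hcont : Continuous fun z : Matrix (Fin n) (Fin m) ℝ × Matrix (Fin n) (Fin m) ℝ =>
      ((c ^ 2 / s) • z.1 - c • z.2, (1 / s) • z.1) := by fun_prop
  have hΦ : Measurable Φ := hΨ.comp hcont.measurable
  have hadd : ∀ M : Matrix (Fin n) (Fin m) ℝ, Measurable fun Z => M + Z := fun M =>
    (continuous_const.add continuous_id).measurable
  have hrisk : ∀ M, ∫⁻ D, frobeniusLoss M D ∂((κ ∘ₖ normalModel n m) M) =
      ∫⁻ Z, Ψ (M, M + Z) ∂μ := by
    intro M
    rw [Kernel.lintegral_comp _ _ _ (measurable_frobeniusLoss_right M)]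
    change ∫⁻ X, Ψ (M, X) ∂(normalMatrix M) = _
    rw [normalMatrix_eq_map M]
    have hΨM : Measurable fun X => Ψ (M, X) := hΨ.comp measurable_prodMk_left
    exact lintegral_map hΨM (hadd M)
  have hswap : ∀ a, ENNReal.ofReal (c ^ 2 * (n * m)) ≤ ∫⁻ b, Φ (a, b) ∂μ := fun a =>
    le_lintegral_lintegral_frobeniusLoss (κ ((1 / s) • a)) ((c ^ 2 / s) • a) c
  calc ENNReal.ofReal (c ^ 2 * (n * m)) = ∫⁻ _, ENNReal.ofReal (c ^ 2 * (n * m)) ∂μ := by simp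
    _ ≤ ∫⁻ a, ∫⁻ b, Φ (a, b) ∂μ ∂μ := lintegral_mono hswap
    _ = ∫⁻ z, Φ z ∂(μ.prod μ) := (lintegral_prod _ hΦ.aemeasurable).symm
    _ = ∫⁻ z, Φ (c • z.1 + s • z.2, -s • z.1 + c • z.2) ∂(μ.prod μ) :=
        (lintegral_rotation_normalMatrix θ hΦ).symm
    _ = ∫⁻ z, Ψ ((c / s) • z.1, (c / s) • z.1 + z.2) ∂(μ.prod μ) := by
        refine lintegral_congr fun z => ?_
        have hcs : c ^ 2 + s ^ 2 = 1 := Real.cos_sq_add_sin_sq θ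
        have e1 : (c ^ 2 / s) • (c • z.1 + s • z.2) - c • (-s • z.1 + c • z.2) =
            (c / s) • z.1 := by
          ext i j
          simp only [Matrix.sub_apply, Matrix.add_apply, Matrix.smul_apply, smul_eq_mul]
          field_simp
          linear_combination (z.1 i j) * c * hcs
        have e2 : (1 / s) • (c • z.1 + s • z.2) = (c / s) • z.1 + z.2 := by
          ext i j
          simp only [Matrix.add_apply, Matrix.smul_apply, smul_eq_mul]
          field_simp
        simp only [Φ, e1, e2]
    _ = ∫⁻ a, ∫⁻ b, Ψ ((c / s) • a, (c / s) • a + b) ∂μ ∂μ := by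
        refine lintegral_prod _ (Measurable.aemeasurable ?_)
        have h2 : Continuous fun z : Matrix (Fin n) (Fin m) ℝ × Matrix (Fin n) (Fin m) ℝ =>
          ((c / s) • z.1, (c / s) • z.1 + z.2) := by fun_prop
        exact hΨ.comp h2.measurable
    _ = ∫⁻ a, ∫⁻ D, frobeniusLoss ((c / s) • a) D
          ∂((κ ∘ₖ normalModel n m) ((c / s) • a)) ∂μ := by simp only [hrisk]
    _ ≤ ∫⁻ _, (⨆ M, ∫⁻ D, frobeniusLoss M D ∂((κ ∘ₖ normalModel n m) M)) ∂μ :=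
        lintegral_mono fun a => le_iSup (fun M => ∫⁻ D, frobeniusLoss M D
          ∂((κ ∘ₖ normalModel n m) M)) ((c / s) • a)
    _ = _ := by simp

theorem le_minimaxRisk :
    ENNReal.ofReal (n * m) ≤ minimaxRisk frobeniusLoss (normalModel n m) := by
  have h1 : Tendsto (fun θ : ℝ => ENNReal.ofReal (Real.cos θ ^ 2 * (n * m))) (𝓝[≠] 0)
      (𝓝 (ENNReal.ofReal (Real.cos 0 ^ 2 * (n * m)))) :=
    (ENNReal.continuous_ofReal.comp (by fun_prop)).continuousAt.tendsto.mono_left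
      nhdsWithin_le_nhds
  rw [Real.cos_zero, one_pow, one_mul] at h1
  refine le_of_tendsto h1 ?_
  have h2 : ∀ᶠ θ : ℝ in 𝓝[≠] 0, Real.sin θ ≠ 0 := by
    filter_upwards [self_mem_nhdsWithin, nhdsWithin_le_nhds
      (Ioo_mem_nhds (neg_lt_zero.mpr Real.pi_pos) Real.pi_pos)] with θ h0 hπ
    exact fun h => h0 ((Real.sin_eq_zero_iff_of_lt_of_lt hπ.1 hπ.2).mp h)
  filter_upwards [h2] with θ hθ
  exact cos_sq_mul_le_minimaxRisk hθ

theorem IsAdmissible.isMinimax (hmn : m ≤ n) {p α : ℝ} (hα : IsAdmissible n m p α) :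
    IsMinimax (normShrinkageEstimator p α : Matrix (Fin n) (Fin m) ℝ → _) := by
  have hmeas := hα.measurable_normShrinkageEstimator hmn
  refine ⟨hmeas, le_antisymm ?_ ?_⟩
  · exact (iSup_le fun M => hα.frobeniusRisk_normShrinkageEstimator_le hmn M).trans le_minimaxRisk
  · have h1 := iInf₂_le (f := fun (κ : Kernel (Matrix (Fin n) (Fin m) ℝ)
        (Matrix (Fin n) (Fin m) ℝ)) (_ : IsMarkovKernel κ) =>
        ⨆ M, ∫⁻ D, frobeniusLoss M D ∂((κ ∘ₖ normalModel n m) M))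
      (Kernel.deterministic _ hmeas) inferInstance
    refine h1.trans (iSup_mono fun M => ?_)
    have hl := measurable_frobeniusLoss_right M
    rw [Kernel.lintegral_comp _ _ _ hl]
    refine (lintegral_congr fun X => ?_).le
    rw [Kernel.lintegral_deterministic' hmeas hl]

end Minimax

end NormalMeanMatrix

theorem theorem1 (n m : ℕ) (hmn : m ≤ n) (p α : ℝ) :
    (p ∈ Set.Icc (1 : ℝ) 2 →
      α ∈ Set.Icc (0 : ℝ) (2 * (n : ℝ) * (m : ℝ) - (2 - p) * (m : ℝ) * ((m : ℝ) + 1) - 2 * p) →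
      NormalMeanMatrix.IsMinimax
        (NormalMeanMatrix.normShrinkageEstimator p α :
          Matrix (Fin n) (Fin m) ℝ → Matrix (Fin n) (Fin m) ℝ)) ∧
    (p ∈ Set.Ioo (0 : ℝ) 1 →
      α ∈ Set.Icc (0 : ℝ)
        (2 * (n : ℝ) * (m : ℝ) - 2 * (m : ℝ) * ((m : ℝ) + 1) + 2 * ((m : ℝ) - 1) * p) →
      NormalMeanMatrix.IsMinimax
        (NormalMeanMatrix.normShrinkageEstimator p α :
          Matrix (Fin n) (Fin m) ℝ → Matrix (Fin n) (Fin m) ℝ)) :=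
  ⟨fun hp hα => NormalMeanMatrix.IsAdmissible.isMinimax hmn ⟨hα.1, Or.inl ⟨hp, hα.2⟩⟩,
    fun hp hα => NormalMeanMatrix.IsAdmissible.isMinimax hmn ⟨hα.1, Or.inr ⟨hp, hα.2⟩⟩⟩
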